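/- **Setting.** Let $N\in\mathbb N$ be a finite horizon, $E=\mathbb R$ the state space, and let the action space $A$ be a Borel space that is a subset of a real vector space. Let $\mathcal Z$ be a measurable space and, for $n=0,\dots,N-1$, let $\mathbb P_{n+1}$ be a separable probability measure on $\mathcal Z$ (the reference law of the disturbance $Z_{n+1}$; we write $Z_{n+1}$ for the identity on $\mathcal Z$). For $n=0,\dots,N-1$ let $D_n\subseteq\mathbb R\times A$ be measurable and contain the graph of a measurable map $\mathbb R\to A$, put $D_n(x)=\{a:(x,a)\in D_n\}$, and let $T_n:D_n\times\mathcal Z\to\mathbb R$ be measurable, $c_n:D_n\times\mathbb R\to\mathbb R$ and $c_N:\mathbb R\to\mathbb R$. Fix $q\in(1,\infty]$ and $p$ with $\frac1p+\frac1q=1$. The ambiguity set $\mathcal Q_{n+1}$ is a non-empty set of probability measures $\mathbb Q\ll\mathbb P_{n+1}$ with $\frac{d\mathbb Q}{d\mathbb P_{n+1}}\in L^q(\mathbb P_{n+1})$; it carries the trace of the weak* topology $\sigma(L^q,L^p)$ (a measure being identified with its density) and the corresponding Borel $\sigma$-algebra. A Markov policy $\pi=(d_0,\dots,d_{N-1})\in\Pi^M$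 of the controller consists of measurable maps $d_n:\mathbb R\to A$ with $d_n(x)\in D_n(x)$; a Markov policy $\gamma=(\gamma_0,\dots,\gamma_{N-1})\in\Gamma^M$ of nature consists of measurable maps $\gamma_n:D_n\to\mathcal Q_{n+1}$. Under $(\pi,\gamma)$ the states $(X_k)$ form a Markov chain whose transition law at time $k$ from $x$ is the law of $T_k(x,d_k(x),Z_{k+1})$ under $\gamma_k(x,d_k(x))$; with $A_k=d_k(X_k)$ let $$J_{n\pi\gamma}(x)=\mathbb E^{\pi\gamma}_{nx}\Big[\sum_{k=n}^{N-1}c_k(X_k,A_k,X_{k+1})+c_N(X_N)\Big],\qquad J_n(x)=\inf_{\pi\in\Pi^M}\sup_{\gamma\in\Gamma^M}J_{n\pi\gamma}(x),$$ where $\mathbb E^{\pi\gamma}_{nx}$ is the expectation given $X_n=x$, and for $v:\mathbb R\to\mathbb R$ let $$L_nv(x,a,\mathbb Q)=\int c_n(x,a,T_n(x,a,z))+v(T_n(x,a,z))\,\mathbb Q(dz),\qquad (x,a)\in D_n,\ \mathbb Q\in\mathcal Q_{n+1}.$$ **Assumptions.** (B) There are $\alpha,\underline\epsilon,\bar\epsilon\ge0$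 with $\underline\epsilon+\bar\epsilon=1$, $\alpha\ne1$, and measurable $\underline b:\mathbb R\to(-\infty,-\underline\epsilon]$, $\bar b:\mathbb R\to[\bar\epsilon,\infty)$ with $\underline b\le c_N\le\bar b$ such that for all $n=0,\dots,N-1$, $\mathbb Q\in\mathcal Q_{n+1}$ and $(x,a)\in D_n$, writing $T=T_n(x,a,Z_{n+1})$, $$\mathbb E^{\mathbb Q}[-c_n^-(x,a,T)]\ge\underline b(x),\quad \mathbb E^{\mathbb Q}[\underline b(T)]\ge\alpha\underline b(x),\quad \mathbb E^{\mathbb Q}[c_n^+(x,a,T)]\le\bar b(x),\quad \mathbb E^{\mathbb Q}[\bar b(T)]\le\alpha\bar b(x).$$ With $b=\bar b-\underline b$, every $(\bar x,\bar a)\in D_n$ has a neighbourhood in $D_n$ and measurable $\Theta_1,\Theta_2:\mathcal Z\to[0,\infty)$ in $L^p(\mathbb P_{n+1})$ such that $|c_n(x,a,T_n(x,a,z))|\le\Theta_1(z)$ and $b(T_n(x,a,z))\le\Theta_2(z)$ for all $(x,a)$ in this neighbourhood and all $z\in\mathcal Z$. The densities $\frac{d\mathbb Q}{d\mathbb P_{n+1}}$,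 $\mathbb Q\in\mathcal Q_{n+1}$, $n=0,\dots,N-1$, are bounded in $L^q$-norm by a common constant. (R) For $n=0,\dots,N-1$: the sets $D_n(x)$ are compact; if $x_k\to x$ and $a_k\in D_n(x_k)$, then $(a_k)$ has an accumulation point in $D_n(x)$; $(x,a)\mapsto T_n(x,a,z)$ is lower semicontinuous on $D_n$ for every $z$; $c_n$ and $c_N$ are lower semicontinuous; $x\mapsto D_n(x)$ is decreasing, i.e. $D_n(x')\subseteq D_n(x)$ for $x\le x'$; $x\mapsto T_n(x,a,z)$, $(x,x')\mapsto c_n(x,a,x')$ and $c_N$ are increasing. (C) For $n=0,\dots,N-1$: the set $D_n$ is convex, and the functions $c_N$, $(x,a)\mapsto T_n(x,a,z)$ (for every $z$) and $(x,a,x')\mapsto c_n(x,a,x')$ are convex. **Theorem.** Under (B), (R) and (C), all the quantities above with $v=J_{n+1}$ are well defined and finite, and for all $n=0,\dots,N-1$ and $x\in\mathbb R$ $$J_n(x)=\inf_{a\in D_n(x)}\ \sup_{\mathbb Q\in\mathcal Q_{n+1}}L_nJ_{n+1}(x,a,\mathbb Q).$$ If the ambiguity set $\mathcal Q_{n+1}$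 is convex, infimum and supremum can be interchanged: $$J_n(x)=\inf_{a\in D_n(x)}\ \sup_{\mathbb Q\in\mathcal Q_{n+1}}L_nJ_{n+1}(x,a,\mathbb Q)=\sup_{\mathbb Q\in\mathcal Q_{n+1}}\ \inf_{a\in D_n(x)}L_nJ_{n+1}(x,a,\mathbb Q).$$ -/

import Mathlib

open MeasureTheory ProbabilityTheory Filter Topology Set
open scoped ENNReal NNReal

noncomputable section

/-- The trace on a set `S` of probability measures, absolutely continuous with respect to `P` and
with densities in `L^q`, of the weak* topology `σ(L^q, L^p)`: a measure is identified with its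
density, and the topology is the coarsest one for which all the pairings `Q ↦ E^P[Y ⬝ dQ/dP]`,
`Y ∈ L^p(P)`, are continuous. -/
@[reducible] def weakStarTopology {Z : Type*} [MeasurableSpace Z] (p : ℝ≥0∞) (P : Measure Z)
    (S : Set (Measure Z)) : TopologicalSpace S :=
  TopologicalSpace.induced
    (fun (Q : S) (Y : Lp ℝ p P) => ∫ z, Y z * ((Q : Measure Z).rnDeriv P z).toReal ∂P)
    Pi.topologicalSpace

/-- The Borel `σ`-algebra of the weak* topology. -/
@[reducible] def weakStarBorel {Z : Type*} [MeasurableSpace Z] (p : ℝ≥0∞) (P : Measure Z)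
    (S : Set (Measure Z)) : MeasurableSpace S :=
  @borel S (weakStarTopology p P S)

/-- Convexity of a set of measures. -/
def IsConvexMeasureSet {Z : Type*} [MeasurableSpace Z] (S : Set (Measure Z)) : Prop :=
  ∀ Q₁ ∈ S, ∀ Q₂ ∈ S, ∀ s t : ℝ≥0, s + t = 1 → s • Q₁ + t • Q₂ ∈ S

/-- The data of a distributionally robust Markov decision model with state space `E`, action space
`A`, disturbance space `Z` and planning horizon `N`. The index `n : Fin N` stands for the decision
times `0, …, N - 1`; `P n` is the reference law of the disturbance `Z_{n+1}` and `𝒬 n` is the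
ambiguity set for that disturbance. -/
structure RobustMDP (E A Z : Type*) [MeasurableSpace E] [MeasurableSpace A] [MeasurableSpace Z]
    (N : ℕ) where
  /-- admissible state-action pairs -/
  D : Fin N → Set (E × A)
  measurableSet_D : ∀ n, MeasurableSet (D n)
  exists_graph : ∀ n, ∃ d : E → A, Measurable d ∧ ∀ x, (x, d x) ∈ D n
  /-- transition functions -/
  T : ∀ n, D n × Z → E
  measurable_T : ∀ n, Measurable (T n)
  /-- one-stage costs -/
  c : ∀ n, D n × E → ℝ
  /-- terminal cost -/
  cN : E → ℝ
  /-- reference laws of the disturbances -/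
  P : Fin N → Measure Z
  isProbabilityMeasure_P : ∀ n, IsProbabilityMeasure (P n)
  isSeparable_P : ∀ n, IsSeparable (P n)
  /-- the conjugate exponents -/
  p : ℝ≥0∞
  q : ℝ≥0∞
  one_lt_q : 1 < q
  conj : p⁻¹ + q⁻¹ = 1
  /-- ambiguity sets -/
  𝒬 : Fin N → Set (Measure Z)
  nonempty_𝒬 : ∀ n, (𝒬 n).Nonempty
  isProbabilityMeasure_𝒬 : ∀ n, ∀ Q ∈ 𝒬 n, IsProbabilityMeasure Q
  absolutelyContinuous_𝒬 : ∀ n, ∀ Q ∈ 𝒬 n, Q ≪ P n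
  memLp_𝒬 : ∀ n, ∀ Q ∈ 𝒬 n, MemLp (fun z => (Q.rnDeriv (P n) z).toReal) q (P n)

namespace RobustMDP

variable {E A Z : Type*} [MeasurableSpace E] [MeasurableSpace A] [MeasurableSpace Z] {N : ℕ}

/-- The section `D_n(x)` of admissible actions in state `x`. -/
def section_D (M : RobustMDP E A Z N) (n : Fin N) (x : E) : Set A := {a | (x, a) ∈ M.D n}

/-- Deterministic Markov policies of the controller. -/
structure Policy (M : RobustMDP E A Z N) where
  d : Fin N → E → A
  measurable_d : ∀ n, Measurable (d n)
  admissible : ∀ n x, (x, d n x) ∈ M.D n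

/-- Markov policies of nature: decision rules `γ_n : D_n → 𝒬_{n+1}`, measurable with respect to the
Borel `σ`-algebra of the weak* topology. -/
structure NaturePolicy (M : RobustMDP E A Z N) where
  γ : ∀ n, M.D n → M.𝒬 n
  measurable_γ : ∀ n, @Measurable _ _ _ (weakStarBorel M.p (M.P n) (M.𝒬 n)) (γ n)

/-- The state-action pair chosen by the controller in state `x`, as an element of `D_n`. -/
def Policy.pair {M : RobustMDP E A Z N} (π : M.Policy) (n : Fin N) (x : E) : M.D n :=
  ⟨(x, π.d n x), π.admissible n x⟩

lemma Policy.measurable_pair {M : RobustMDP E A Z N} (π : M.Policy) (n : Fin N) :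
    Measurable (π.pair n) :=
  (measurable_id.prodMk (π.measurable_d n)).subtype_mk

/-- A decision rule of nature is a stochastic kernel. -/
lemma NaturePolicy.measurable_coe {M : RobustMDP E A Z N} (γ : M.NaturePolicy) (n : Fin N) :
    Measurable (fun y : M.D n => (γ.γ n y : Measure Z)) := by
  refine Measure.measurable_of_measurable_coe _ fun B hB => ?_
  have hP := M.isProbabilityMeasure_P n
  let F : M.𝒬 n → ℝ := fun Q =>
    ∫ z, (indicatorConstLp M.p hB (measure_ne_top (M.P n) B) (1 : ℝ)) z *
      ((Q : Measure Z).rnDeriv (M.P n) z).toReal ∂(M.P n)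
  have hF : @Measurable _ _ (weakStarBorel M.p (M.P n) (M.𝒬 n)) _ F := by
    let _ : TopologicalSpace (M.𝒬 n) := weakStarTopology M.p (M.P n) (M.𝒬 n)
    let _ : MeasurableSpace (M.𝒬 n) := weakStarBorel M.p (M.P n) (M.𝒬 n)
    have _ : BorelSpace (M.𝒬 n) := ⟨rfl⟩
    have hc : Continuous (fun (Q : M.𝒬 n) (Y : Lp ℝ M.p (M.P n)) =>
        ∫ z, Y z * ((Q : Measure Z).rnDeriv (M.P n) z).toReal ∂(M.P n)) :=
      continuous_induced_dom
    exact ((continuous_apply _).comp hc).measurable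
  have hval : ∀ Q : M.𝒬 n, (Q : Measure Z) B = ENNReal.ofReal (F Q) := by
    intro Q
    have hQ := M.isProbabilityMeasure_𝒬 n Q Q.2
    have hac := M.absolutelyContinuous_𝒬 n Q Q.2
    have h1 : F Q = ∫ z in B, ((Q : Measure Z).rnDeriv (M.P n) z).toReal ∂(M.P n) := by
      rw [← integral_indicator hB]
      refine integral_congr_ae ?_
      filter_upwards [indicatorConstLp_coeFn (p := M.p) (hs := hB)
        (hμs := measure_ne_top (M.P n) B) (c := (1 : ℝ))] with z hz
      rw [hz]
      by_cases hzB : z ∈ B <;> simp [hzB]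
    rw [h1, Measure.setIntegral_toReal_rnDeriv hac, measureReal_def,
      ENNReal.ofReal_toReal (measure_ne_top _ _)]
  simp only [hval]
  exact (hF.comp (γ.measurable_γ n)).ennreal_ofReal

/-- The law of the disturbance `Z_{n+1}` given the state at time `n`. -/
def disturbanceKernel (M : RobustMDP E A Z N) (π : M.Policy) (γ : M.NaturePolicy) (n : Fin N) :
    Kernel E Z where
  toFun x := (γ.γ n (π.pair n x) : Measure Z)
  measurable' := (γ.measurable_coe n).comp (π.measurable_pair n)

instance (M : RobustMDP E A Z N) (π : M.Policy) (γ : M.NaturePolicy) (n : Fin N) :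
    IsMarkovKernel (M.disturbanceKernel π γ n) :=
  ⟨fun x => M.isProbabilityMeasure_𝒬 n _ (γ.γ n (π.pair n x)).2⟩

lemma measurable_next (M : RobustMDP E A Z N) (π : M.Policy) (n : Fin N) :
    Measurable (fun y : E × Z => M.T n (π.pair n y.1, y.2)) :=
  (M.measurable_T n).comp (((π.measurable_pair n).comp measurable_fst).prodMk measurable_snd)

/-- The transition kernel of the state process: the law of `T_n(x, d_n(x), Z_{n+1})` when `Z_{n+1}`
has the law `γ_n(x, d_n(x))`. -/
def transition (M : RobustMDP E A Z N) (π : M.Policy) (γ : M.NaturePolicy) (n : Fin N) :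
    Kernel E E :=
  (Kernel.id ×ₖ M.disturbanceKernel π γ n).map (fun y : E × Z => M.T n (π.pair n y.1, y.2))

instance (M : RobustMDP E A Z N) (π : M.Policy) (γ : M.NaturePolicy) (n : Fin N) :
    IsMarkovKernel (M.transition π γ n) :=
  Kernel.IsMarkovKernel.map _ (M.measurable_next π n)

/-- The transition kernels, as functions of the state history; from time `N` on the (irrelevant)
state process is continued as a constant. -/
def historyKernel (M : RobustMDP E A Z N) (π : M.Policy) (γ : M.NaturePolicy) (k : ℕ) :
    Kernel ((i : Finset.Iic k) → (fun _ : ℕ => E) i) E :=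
  if h : k < N then
    (M.transition π γ ⟨k, h⟩).comap (fun ω => ω ⟨k, Finset.mem_Iic.2 le_rfl⟩)
      (measurable_pi_apply _)
  else Kernel.deterministic (fun ω => ω ⟨k, Finset.mem_Iic.2 le_rfl⟩) (measurable_pi_apply _)

instance (M : RobustMDP E A Z N) (π : M.Policy) (γ : M.NaturePolicy) (k : ℕ) :
    IsMarkovKernel (M.historyKernel π γ k) := by
  unfold historyKernel
  split_ifs <;> infer_instance

/-- The (Ionescu-Tulcea) law of the state process `(X_k)` under `(π, γ)` given `X_n = x`; the
irrelevant coordinates before time `n` are also put equal to `x`. -/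
def law (M : RobustMDP E A Z N) (π : M.Policy) (γ : M.NaturePolicy) (n : ℕ) (x : E) :
    Measure (ℕ → E) :=
  Kernel.traj (X := fun _ => E) (M.historyKernel π γ) n (fun _ => x)

/-- The cost `∑_{k=n}^{N-1} c_k(X_k, A_k, X_{k+1}) + c_N(X_N)`, where `A_k = d_k(X_k)`. -/
def totalCost (M : RobustMDP E A Z N) (π : M.Policy) (n : ℕ) (ω : ℕ → E) : ℝ :=
  (∑ k : Fin N, if n ≤ (k : ℕ) then M.c k (π.pair k (ω k), ω (k + 1)) else 0) + M.cN (ω N)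

/-- `J_{nπγ}(x)`. -/
def policyValue (M : RobustMDP E A Z N) (π : M.Policy) (γ : M.NaturePolicy) (n : ℕ) (x : E) : ℝ :=
  ∫ ω, M.totalCost π n ω ∂(M.law π γ n x)

/-- The Markovian value function `J_n(x) = inf_π sup_γ J_{nπγ}(x)`, as an extended real. -/
def valueE (M : RobustMDP E A Z N) (n : ℕ) (x : E) : EReal :=
  ⨅ π : M.Policy, ⨆ γ : M.NaturePolicy, (M.policyValue π γ n x : EReal)

/-- The Markovian value function as a real function (used only where `valueE` is finite). -/
def value (M : RobustMDP E A Z N) (n : ℕ) (x : E) : ℝ := (M.valueE n x).toReal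

/-- The integrand `c_n(x, a, T_n(x, a, z)) + v(T_n(x, a, z))`. -/
def stageCost (M : RobustMDP E A Z N) (n : Fin N) (v : E → ℝ) (y : M.D n) (z : Z) : ℝ :=
  M.c n (y, M.T n (y, z)) + v (M.T n (y, z))

/-- The operator `L_n v(x, a, Q)`. -/
def L (M : RobustMDP E A Z N) (n : Fin N) (v : E → ℝ) (y : M.D n) (Q : Measure Z) : ℝ :=
  ∫ z, M.stageCost n v y z ∂Q

/-- Bounding functions, local `L^p`-bounds and norm boundedness of the ambiguity sets. The
inequalities `E^Q[-f] ≥ -r` for `f, r ≥ 0` are written as `∫⁻ f ≤ r`. -/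
structure IsBounded [TopologicalSpace E] [TopologicalSpace A] (M : RobustMDP E A Z N) : Prop where
  bounding : ∃ (α εl εu : ℝ) (bl bu : E → ℝ), 0 ≤ α ∧ α ≠ 1 ∧ 0 ≤ εl ∧ 0 ≤ εu ∧ εl + εu = 1 ∧
    Measurable bl ∧ Measurable bu ∧ (∀ x, bl x ≤ -εl) ∧ (∀ x, εu ≤ bu x) ∧
    (∀ n, ∀ Q ∈ M.𝒬 n, ∀ y : M.D n,
      ∫⁻ z, ENNReal.ofReal (-M.c n (y, M.T n (y, z))) ∂Q ≤ ENNReal.ofReal (-bl y.1.1) ∧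
      ∫⁻ z, ENNReal.ofReal (-bl (M.T n (y, z))) ∂Q ≤ ENNReal.ofReal (α * -bl y.1.1) ∧
      ∫⁻ z, ENNReal.ofReal (M.c n (y, M.T n (y, z))) ∂Q ≤ ENNReal.ofReal (bu y.1.1) ∧
      ∫⁻ z, ENNReal.ofReal (bu (M.T n (y, z))) ∂Q ≤ ENNReal.ofReal (α * bu y.1.1)) ∧
    (∀ x, bl x ≤ M.cN x ∧ M.cN x ≤ bu x) ∧
    (∀ n, ∀ y₀ : M.D n, ∃ Θ₁ Θ₂ : Z → ℝ, Measurable Θ₁ ∧ Measurable Θ₂ ∧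
      (∀ z, 0 ≤ Θ₁ z) ∧ (∀ z, 0 ≤ Θ₂ z) ∧ MemLp Θ₁ M.p (M.P n) ∧ MemLp Θ₂ M.p (M.P n) ∧
      ∀ᶠ y in 𝓝 y₀, ∀ z, |M.c n (y, M.T n (y, z))| ≤ Θ₁ z ∧
        bu (M.T n (y, z)) - bl (M.T n (y, z)) ≤ Θ₂ z)
  norm_bounded : ∃ K : ℝ≥0, 1 ≤ K ∧ ∀ n, ∀ Q ∈ M.𝒬 n,
    eLpNorm (fun z => (Q.rnDeriv (M.P n) z).toReal) M.q (M.P n) ≤ K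

/-- The semicontinuity, compactness and monotonicity assumptions for the real state space. -/
structure IsMonotoneModel [TopologicalSpace A] (M : RobustMDP ℝ A Z N) : Prop where
  isCompact_section : ∀ n x, IsCompact (M.section_D n x)
  /-- upper semicontinuity of the set-valued map `x ↦ D_n(x)` -/
  usc_section : ∀ n, ∀ (x : ℝ) (xs : ℕ → ℝ) (as : ℕ → A), Tendsto xs atTop (𝓝 x) →
    (∀ k, as k ∈ M.section_D n (xs k)) → ∃ a ∈ M.section_D n x, MapClusterPt a atTop as
  lsc_T : ∀ n z, LowerSemicontinuous (fun y : M.D n => M.T n (y, z))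
  lsc_c : ∀ n, LowerSemicontinuous (M.c n)
  lsc_cN : LowerSemicontinuous M.cN
  antitone_section : ∀ n, Antitone (M.section_D n)
  monotone_T : ∀ n (y y' : M.D n) (z : Z), y.1.2 = y'.1.2 → y.1.1 ≤ y'.1.1 →
    M.T n (y, z) ≤ M.T n (y', z)
  monotone_c : ∀ n (y y' : M.D n) (w w' : ℝ), y.1.2 = y'.1.2 → y.1.1 ≤ y'.1.1 → w ≤ w' →
    M.c n (y, w) ≤ M.c n (y', w')
  monotone_cN : Monotone M.cN

/-- `y = s y₁ + t y₂` in `ℝ × V`, for state-action pairs whose actions are elements of a subset `A`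
of the real vector space `V`. -/
def IsComb {V : Type*} [AddCommGroup V] [Module ℝ V] {A : Set V} (s t : ℝ) (y₁ y₂ y : ℝ × A) :
    Prop :=
  y.1 = s * y₁.1 + t * y₂.1 ∧ (y.2 : V) = s • (y₁.2 : V) + t • (y₂.2 : V)

/-- Convexity of the sets `D_n ⊆ ℝ × V`, of the terminal cost, and of the functions
`(x, a) ↦ T_n(x, a, z)` and `(x, a, x') ↦ c_n(x, a, x')`. -/
structure IsConvexModel {V : Type*} [AddCommGroup V] [Module ℝ V] {A : Set V} [MeasurableSpace A]
    (M : RobustMDP ℝ A Z N) : Prop where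
  convex_D : ∀ n, Convex ℝ ((fun y : ℝ × A => (y.1, (y.2 : V))) '' M.D n)
  convex_cN : ConvexOn ℝ univ M.cN
  convex_T : ∀ n (z : Z) (s t : ℝ), 0 ≤ s → 0 ≤ t → s + t = 1 → ∀ y₁ y₂ y : M.D n,
    IsComb s t y₁.1 y₂.1 y.1 → M.T n (y, z) ≤ s * M.T n (y₁, z) + t * M.T n (y₂, z)
  convex_c : ∀ n (s t : ℝ), 0 ≤ s → 0 ≤ t → s + t = 1 → ∀ (y₁ y₂ y : M.D n) (w₁ w₂ : ℝ),
    IsComb s t y₁.1 y₂.1 y.1 →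
      M.c n (y, s * w₁ + t * w₂) ≤ s * M.c n (y₁, w₁) + t * M.c n (y₂, w₂)

end RobustMDP

end

/-! The theorem is proved by comparing the value functions with the iterates `bellmanIter` of the
Bellman operator, started from the terminal cost. Since costs and transitions increase with the
state and the action sets shrink, the operator preserves monotone functions; since everything is
jointly convex, it preserves monotone convex functions. A finite convex function on the line is
continuous, so every iterate is increasing, continuous and bounded by a multiple of `b`.

No exact minimizers or maximizers are selected. Nature needs only countably many measures: `L^p` is
separable and the densities are bounded in `L^q`, so a sequence in the ambiguity set exhausts all
suprema (`exists_seq_integral_le_add`), and taking the first good index is measurable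
(`exists_nature_rule`). The controller needs only countably many actions, chosen at a dense set of
states and reused slightly to the left (`exists_decision_rule`). An error `ε` per stage adds up to
at most `N ε`, and `valueE_eq` squeezes the value between the two estimates; `policyValue_eq`
connects trajectory expectations with backward recursion.

For a convex ambiguity set, `L` is affine in the measure and convex and lower semicontinuous in the
action, which ranges over a compact set. The interchange is then the minimax theorem
`exists_forall_le_of_forall_exists_lt`, a finite-dimensional separation argument. -/

/-! ### Duality of `L^p` and `L^q`, and countable reduction of suprema. -/

/-- **Hölder's inequality** for a change of measure. -/
lemma integrable_of_memLp_rnDeriv {Z : Type*} [MeasurableSpace Z] {p q : ℝ≥0∞}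
    (hpq : p⁻¹ + q⁻¹ = 1) {P Q : Measure Z} [IsFiniteMeasure P] [IsFiniteMeasure Q] (hQ : Q ≪ P)
    (hρ : MemLp (fun z => (Q.rnDeriv P z).toReal) q P) {f : Z → ℝ} (hf : MemLp f p P) :
    Integrable f Q := by
  have : ENNReal.HolderConjugate p q := ENNReal.holderConjugate_iff.2 hpq
  rw [← integrable_rnDeriv_smul_iff hQ]
  exact memLp_one_iff_integrable.1 (hf.smul hρ)

lemma abs_integral_le_of_memLp_rnDeriv {Z : Type*} [MeasurableSpace Z] {p q : ℝ≥0∞}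
    (hpq : p⁻¹ + q⁻¹ = 1) {P Q : Measure Z} [IsFiniteMeasure P] [IsFiniteMeasure Q] (hQ : Q ≪ P)
    (hρ : MemLp (fun z => (Q.rnDeriv P z).toReal) q P) {K : ℝ≥0}
    (hK : eLpNorm (fun z => (Q.rnDeriv P z).toReal) q P ≤ K) {f : Z → ℝ} (hf : MemLp f p P) :
    |∫ z, f z ∂Q| ≤ K * (eLpNorm f p P).toReal := by
  have : ENNReal.HolderConjugate p q := ENNReal.holderConjugate_iff.2 hpq
  rw [← integral_rnDeriv_smul hQ, ← Real.norm_eq_abs]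
  refine (norm_integral_le_lintegral_norm _).trans ?_
  have h : eLpNorm ((fun z => (Q.rnDeriv P z).toReal) • f) 1 P ≤ K * eLpNorm f p P :=
    (eLpNorm_smul_le_mul_eLpNorm hf.1 hρ.1).trans (by gcongr)
  rw [eLpNorm_one_eq_lintegral_enorm] at h
  have h' := ENNReal.toReal_mono (ENNReal.mul_ne_top ENNReal.coe_ne_top hf.2.ne) h
  rw [ENNReal.toReal_mul, ENNReal.coe_toReal] at h'
  simpa only [ofReal_norm, Pi.smul_apply', enorm_smul] using h'

/-- For a norm bounded set `S` of measures with densities in `L^q`, suprema of integrals of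
`L^p`-functions over `S` can be computed along one sequence in `S`. -/
lemma exists_seq_integral_le_add {Z : Type*} [MeasurableSpace Z] {p q : ℝ≥0∞}
    (hpq : p⁻¹ + q⁻¹ = 1) (hq : 1 < q) {P : Measure Z} [IsFiniteMeasure P] [IsSeparable P]
    {S : Set (Measure Z)} (hS : S.Nonempty) (hfin : ∀ Q ∈ S, IsProbabilityMeasure Q)
    (hac : ∀ Q ∈ S, Q ≪ P) (hρ : ∀ Q ∈ S, MemLp (fun z => (Q.rnDeriv P z).toReal) q P)
    {K : ℝ≥0} (hK : ∀ Q ∈ S, eLpNorm (fun z => (Q.rnDeriv P z).toReal) q P ≤ K) :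
    ∃ Qs : ℕ → S, ∀ f : Z → ℝ, MemLp f p P → ∀ Q ∈ S, ∀ ε > 0, ∃ k,
      ∫ z, f z ∂Q ≤ ∫ z, f z ∂(Qs k : Measure Z) + ε := by
  have hconj : ENNReal.HolderConjugate p q := ENNReal.holderConjugate_iff.2 hpq
  have hp1 : Fact (1 ≤ p) := ⟨ENNReal.HolderConjugate.one_le p q⟩
  -- The condition `1 < q` means `p < ∞`; together with separability of `P` this makes `L^p`
  -- separable.
  have hptop : Fact (p ≠ ∞) := ⟨by
    rintro rfl
    rw [ENNReal.inv_top, zero_add, ENNReal.inv_eq_one] at hpq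
    exact hq.ne' hpq⟩
  obtain ⟨Y, hY⟩ := TopologicalSpace.exists_dense_seq (Lp ℝ p P)
  have hsup : ∀ j m : ℕ, ∃ Q' : S, ∀ Q ∈ S,
      ∫ z, Y j z ∂Q ≤ ∫ z, Y j z ∂(Q' : Measure Z) + 1 / ((m : ℝ) + 1) := by
    intro j m
    have : Nonempty S := hS.to_subtype
    have hbdd : BddAbove (range fun Q : S => ∫ z, Y j z ∂(Q : Measure Z)) := by
      refine ⟨K * (eLpNorm (Y j) p P).toReal, ?_⟩
      rintro _ ⟨Q, rfl⟩
      have := hfin Q Q.2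
      exact (le_abs_self _).trans (abs_integral_le_of_memLp_rnDeriv hpq (hac Q Q.2) (hρ Q Q.2)
        (hK Q Q.2) (Lp.memLp (Y j)))
    obtain ⟨Q', hQ'⟩ := exists_lt_of_lt_ciSup (f := fun Q : S => ∫ z, Y j z ∂(Q : Measure Z))
      (sub_lt_self (⨆ Q : S, ∫ z, Y j z ∂(Q : Measure Z)) (Nat.one_div_pos_of_nat (n := m)
        (α := ℝ)))
    refine ⟨Q', fun Q hQ => ?_⟩
    have := le_ciSup hbdd ⟨Q, hQ⟩
    simp only at this
    linarith
  choose R hR using hsup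
  -- `R j m` is a `1/(m+1)`-maximizer for the dense element `Y j`; the pairs `(j, m)` are enumerated
  -- by one index.
  refine ⟨fun i => R i.unpair.1 i.unpair.2, fun f hf Q hQ ε hε => ?_⟩
  obtain ⟨m, hm⟩ := exists_nat_one_div_lt (half_pos hε)
  -- The norm bound `K` turns this distance into an error `ε/4`, uniformly over `S`. It is paid
  -- twice, and `m` accounts for the other `ε/2`.
  obtain ⟨j, hj⟩ : ∃ j, dist (hf.toLp f) (Y j) < ε / (4 * (K + 1)) :=
    hY.exists_dist_lt _ (by positivity)
  refine ⟨Nat.pair j m, ?_⟩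
  simp only [Nat.unpair_pair]
  have key : ∀ Q' ∈ S, |∫ z, f z ∂Q' - ∫ z, Y j z ∂Q'| ≤ ε / 4 := by
    intro Q' hQ'
    have := hfin Q' hQ'
    have hYm := Lp.memLp (Y j)
    rw [← integral_sub (integrable_of_memLp_rnDeriv hpq (hac Q' hQ') (hρ Q' hQ') hf)
      (integrable_of_memLp_rnDeriv hpq (hac Q' hQ') (hρ Q' hQ') hYm)]
    refine (abs_integral_le_of_memLp_rnDeriv hpq (hac Q' hQ') (hρ Q' hQ') (hK Q' hQ')
      (hf.sub hYm)).trans ?_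
    have hn : (eLpNorm (f - ⇑(Y j)) p P).toReal = dist (hf.toLp f) (Y j) := by
      rw [Lp.dist_def]
      congr 1
      exact eLpNorm_congr_ae (hf.coeFn_toLp.symm.sub (EventuallyEq.refl _ _))
    change K * (eLpNorm (f - ⇑(Y j)) p P).toReal ≤ _
    rw [hn]
    have hK0 : (0 : ℝ) ≤ K := K.2
    calc (K : ℝ) * dist (hf.toLp f) (Y j) ≤ (K + 1) * (ε / (4 * (K + 1))) := by
          gcongr
          linarith
      _ = ε / 4 := by field_simp
  have h1 := abs_le.1 (key Q hQ)
  have h2 := abs_le.1 (key (R j m) (R j m).2)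
  have h3 := hR j m Q hQ
  linarith [h1.1, h1.2, h2.1, h2.2]

/-! ### A minimax theorem by separation of convex sets. -/

/-- A **minimax theorem** for functions which are convex-like and lower semicontinuous in the first
(compact) variable and concave-like in the second variable. -/
theorem exists_forall_le_of_forall_exists_lt {X ι : Type*} [TopologicalSpace X] [CompactSpace X]
    [Nonempty X] {f : X → ι → ℝ} (hlsc : ∀ i, LowerSemicontinuous fun x => f x i)
    (hconv : ∀ s t : ℝ, 0 ≤ s → 0 ≤ t → s + t = 1 → ∀ x y, ∃ w, ∀ i,
      f w i ≤ s * f x i + t * f y i)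
    (hconc : ∀ s t : ℝ, 0 ≤ s → 0 ≤ t → s + t = 1 → ∀ i j, ∃ k, ∀ x,
      s * f x i + t * f x j ≤ f x k)
    {r : ℝ} (hr : ∀ x, ∃ i, r < f x i) : ∃ i, ∀ x, r ≤ f x i := by
  classical
  obtain ⟨F, hF⟩ : ∃ F : Finset ι, ∀ x, ∃ i ∈ F, r < f x i := by
    obtain ⟨F, hF⟩ := isCompact_univ.elim_finite_subcover (fun i => {x | r < f x i})
      (fun i => (hlsc i).isOpen_preimage r) (fun x _ => mem_iUnion.2 (hr x))
    refine ⟨F, fun x => ?_⟩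
    simpa using hF (mem_univ x)
  -- The upward closure of the image of `X` is convex although the image itself need not be. It
  -- misses the open orthant `U` because some index in `F` always exceeds `r`.
  let C : Set (F → ℝ) := {t | ∃ x, ∀ i : F, f x i ≤ t i}
  let U : Set (F → ℝ) := {t | ∀ i, t i < r}
  have hC : Convex ℝ C := by
    rintro t₁ ⟨x, hx⟩ t₂ ⟨y, hy⟩ a b ha hb hab
    obtain ⟨w, hw⟩ := hconv a b ha hb hab x y
    refine ⟨w, fun i => (hw i).trans ?_⟩
    simp only [Pi.add_apply, Pi.smul_apply, smul_eq_mul]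
    gcongr
    exacts [hx i, hy i]
  have hU' : U = ⋂ i : F, (fun t : F → ℝ => t i) ⁻¹' Iio r := by
    ext t
    simp [U]
  have hU : Convex ℝ U := by
    rw [hU']
    exact convex_iInter fun i =>
      (convex_Iio r).linear_preimage (LinearMap.proj (R := ℝ) (φ := fun _ : F => ℝ) i)
  have hUo : IsOpen U := by
    rw [hU']
    exact isOpen_iInter_of_finite fun i => isOpen_Iio.preimage (continuous_apply i)
  have hdisj : Disjoint U C := by
    rw [Set.disjoint_left]
    rintro t ht ⟨x, hx⟩
    obtain ⟨i, hi, hlt⟩ := hF x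
    exact absurd (hx ⟨i, hi⟩) (not_le.2 ((ht ⟨i, hi⟩).trans hlt))
  obtain ⟨φ, u, hφU, hφC⟩ := geometric_hahn_banach_open hU hUo hC hdisj
  let l : F → ℝ := fun i => φ (Pi.single i 1)
  have hφ : ∀ t : F → ℝ, φ t = ∑ i, l i * t i := by
    intro t
    conv_lhs => rw [pi_eq_sum_univ' t]
    simp only [map_sum, l]
    refine Finset.sum_congr rfl fun i _ => ?_
    rw [map_smul, smul_eq_mul, mul_comm]
  obtain ⟨x₀⟩ := ‹Nonempty X›
  -- `C` is stable under increasing a coordinate, so a negative multiplier would drive `φ` below `u`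
  -- on `C`; the `m` used in `h1` gives the value `u - 1`.
  have hl : ∀ i, 0 ≤ l i := by
    intro i
    by_contra! hneg
    let t₀ : F → ℝ := fun j => f x₀ j
    have hm : ∀ m : ℝ, 0 ≤ m → u ≤ φ t₀ + m * l i := by
      intro m hm
      have := hφC (t₀ + m • Pi.single i 1) ⟨x₀, fun j => by
        have : 0 ≤ m * (Pi.single i 1 : F → ℝ) j := by
          by_cases hij : j = i <;> simp [hij, hm]
        simpa [t₀] using this⟩
      simpa [map_add, map_smul, l] using this
    have h0 := hm 0 le_rfl
    have h1 := hm ((φ t₀ - u + 1) / (-l i)) (div_nonneg (by linarith) (by linarith))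
    have h2 : (φ t₀ - u + 1) / (-l i) * l i = -(φ t₀ - u + 1) := by
      have := hneg.ne
      field_simp
    linarith
  have hur : r * ∑ i, l i ≤ u := by
    have hlim : Tendsto (fun e : ℝ => (r - e) * ∑ i, l i) (𝓝[>] 0) (𝓝 ((r - 0) * ∑ i, l i)) := by
      refine Tendsto.mono_left ?_ nhdsWithin_le_nhds
      exact (Continuous.tendsto (by fun_prop) 0)
    rw [sub_zero] at hlim
    refine le_of_tendsto hlim ?_
    filter_upwards [self_mem_nhdsWithin] with e he
    have := (hφU (fun _ => r - e) fun i => sub_lt_self r he).le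
    rw [hφ] at this
    rwa [Finset.mul_sum, Finset.sum_congr rfl fun i _ => mul_comm _ _]
  have hlpos : 0 < ∑ i, l i := by
    refine (Finset.sum_nonneg fun i _ => hl i).lt_of_ne fun h0 => ?_
    have hz : ∀ i, l i = 0 := by
      intro i
      exact (Finset.sum_eq_zero_iff_of_nonneg fun i _ => hl i).1 h0.symm i (Finset.mem_univ i)
    have h1 := hφU (fun _ => r - 1) fun i => by linarith
    have h2 := hφC (fun j => f x₀ j) ⟨x₀, fun j => le_rfl⟩
    rw [hφ] at h1 h2
    simp only [hz, zero_mul, Finset.sum_const_zero] at h1 h2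
    linarith
  -- This passes from the two-term concavity hypothesis to the finite combination with the
  -- normalized multipliers as weights.
  have hG : Convex ℝ {g : X → ℝ | ∃ k, ∀ x, g x ≤ f x k} := by
    rintro g₁ ⟨i, hi⟩ g₂ ⟨j, hj⟩ a b ha hb hab
    obtain ⟨k, hk⟩ := hconc a b ha hb hab i j
    refine ⟨k, fun x => le_trans ?_ (hk x)⟩
    simp only [Pi.add_apply, Pi.smul_apply, smul_eq_mul]
    gcongr
    exacts [hi x, hj x]
  obtain ⟨k, hk⟩ := hG.sum_mem (t := Finset.univ) (w := fun i : F => l i / ∑ i, l i)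
    (z := fun (i : F) x => f x i) (fun i _ => div_nonneg (hl i) hlpos.le)
    (by rw [← Finset.sum_div, div_self hlpos.ne']) (fun i _ => ⟨i, fun x => le_rfl⟩)
  refine ⟨k, fun x => le_trans ?_ (hk x)⟩
  have h1 := hφC (fun j => f x j) ⟨x, fun j => le_rfl⟩
  rw [hφ] at h1
  simp only [Finset.sum_apply, Pi.smul_apply, smul_eq_mul, div_mul_eq_mul_div]
  rw [← Finset.sum_div, le_div_iff₀ hlpos]
  exact hur.trans h1

/-! ### Lower semicontinuity of parameter integrals. -/

/-- **Fatou's lemma** as a semicontinuity statement: an integral of functions which are lower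
semicontinuous in a parameter and locally bounded below by an integrable function is lower
semicontinuous. -/
lemma lowerSemicontinuous_integral {X Z : Type*} [TopologicalSpace X] [FirstCountableTopology X]
    [MeasurableSpace Z] {μ : Measure Z} {f : X → Z → ℝ} (hint : ∀ x, Integrable (f x) μ)
    (hlsc : ∀ z, LowerSemicontinuous fun x => f x z)
    (hbdd : ∀ x₀, ∃ Θ : Z → ℝ, Integrable Θ μ ∧ ∀ᶠ x in 𝓝 x₀, ∀ z, -Θ z ≤ f x z) :
    LowerSemicontinuous fun x => ∫ z, f x z ∂μ := by
  intro x₀ r hr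
  obtain ⟨Θ, hΘ, hle⟩ := hbdd x₀
  by_contra hcon
  rw [not_eventually] at hcon
  -- First countability reduces a failure of semicontinuity to a sequence, along which Fatou's lemma
  -- applies to the nonnegative functions `f + Θ`.
  obtain ⟨xs, hxs, hxr⟩ := exists_seq_forall_of_frequently (hcon.and_eventually hle)
  have hnn : ∀ x, (∀ z, -Θ z ≤ f x z) →
      ∫⁻ z, ENNReal.ofReal (f x z + Θ z) ∂μ = ENNReal.ofReal (∫ z, f x z ∂μ + ∫ z, Θ z ∂μ) := by
    intro x hx
    rw [← integral_add (hint x) hΘ]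
    exact (ofReal_integral_eq_lintegral_ofReal ((hint x).add hΘ)
      (ae_of_all _ fun z => by simpa using by linarith [hx z])).symm
  have hFatou : ∫⁻ z, ENNReal.ofReal (f x₀ z + Θ z) ∂μ ≤
      liminf (fun k => ∫⁻ z, ENNReal.ofReal (f (xs k) z + Θ z) ∂μ) atTop := by
    refine le_trans (lintegral_mono fun z => ?_) (lintegral_liminf_le'
      fun k => ((hint (xs k)).add hΘ).1.aemeasurable.ennreal_ofReal)
    refine le_of_forall_lt fun c hc => ?_
    obtain ⟨c', hcc', hc'⟩ := exists_between hc
    refine hcc'.trans_le (le_liminf_of_le (by isBoundedDefault) ?_)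
    have hc'top : c' ≠ ∞ := hc'.ne_top
    rw [ENNReal.lt_ofReal_iff_toReal_lt hc'top] at hc'
    have hev := hxs.eventually (hlsc z x₀ (c'.toReal - Θ z) (by linarith))
    filter_upwards [hev] with k hk
    exact ((ENNReal.lt_ofReal_iff_toReal_lt hc'top).2 (by linarith)).le
  rw [hnn x₀ hle.self_of_nhds] at hFatou
  have hub : liminf (fun k => ∫⁻ z, ENNReal.ofReal (f (xs k) z + Θ z) ∂μ) atTop ≤
      ENNReal.ofReal (r + ∫ z, Θ z ∂μ) := by
    refine liminf_le_of_le (by isBoundedDefault) fun b hb => ?_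
    obtain ⟨k, hk⟩ := hb.exists
    refine hk.trans ?_
    rw [hnn _ (hxr k).2]
    exact ENNReal.ofReal_le_ofReal (by linarith [not_lt.1 (hxr k).1])
  -- It follows that `r + ∫ Θ ≥ 0`, so the truncation in `ENNReal.ofReal` loses nothing when
  -- returning to real numbers.
  have h0 : 0 ≤ ∫ z, f (xs 0) z ∂μ + ∫ z, Θ z ∂μ := by
    rw [← integral_add (hint _) hΘ]
    exact integral_nonneg fun z => by simpa using by linarith [(hxr 0).2 z]
  have h1 := (ENNReal.ofReal_le_ofReal_iff
    (by linarith [not_lt.1 (hxr 0).1])).1 (hFatou.trans hub)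
  linarith

/-! ### Bounding functions and integrability. -/

namespace RobustMDP

/-- Domination of the one-stage and terminal costs by a bounding function `b` whose conditional
expectation grows by at most the factor `α` per stage. -/
structure IsDominated {E A Z : Type*} [MeasurableSpace E] [MeasurableSpace A] [MeasurableSpace Z]
    {N : ℕ} (M : RobustMDP E A Z N) (α : ℝ) (b : E → ℝ) : Prop where
  nonneg_α : 0 ≤ α
  measurable_b : Measurable b
  nonneg_b : ∀ x, 0 ≤ b x
  measurable_c : ∀ n, Measurable (M.c n)
  measurable_cN : Measurable M.cN
  lintegral_c_le : ∀ n, ∀ Q ∈ M.𝒬 n, ∀ y : M.D n,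
    ∫⁻ z, ‖M.c n (y, M.T n (y, z))‖ₑ ∂Q ≤ ENNReal.ofReal (b y.1.1)
  lintegral_b_le : ∀ n, ∀ Q ∈ M.𝒬 n, ∀ y : M.D n,
    ∫⁻ z, ENNReal.ofReal (b (M.T n (y, z))) ∂Q ≤ ENNReal.ofReal (α * b y.1.1)
  abs_cN_le : ∀ x, |M.cN x| ≤ b x

variable {E A Z : Type*} [MeasurableSpace E] [MeasurableSpace A] [MeasurableSpace Z] {N : ℕ}
  {M : RobustMDP E A Z N} {α : ℝ} {b : E → ℝ}

lemma IsDominated.measurable_stageCost (h : M.IsDominated α b) (n : Fin N) {v : E → ℝ}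
    (hv : Measurable v) : Measurable fun y : M.D n × Z => M.stageCost n v y.1 y.2 := by
  have hT := M.measurable_T n
  exact ((h.measurable_c n).comp (measurable_fst.prodMk hT)).add (hv.comp hT)

lemma IsDominated.lintegral_mul_le (h : M.IsDominated α b) (n : Fin N) {C : ℝ} (hC : 0 ≤ C)
    {Q : Measure Z} (hQ : Q ∈ M.𝒬 n) (y : M.D n) :
    ∫⁻ z, ENNReal.ofReal (C * b (M.T n (y, z))) ∂Q ≤ ENNReal.ofReal (C * (α * b y.1.1)) := by
  simp only [ENNReal.ofReal_mul hC]
  rw [lintegral_const_mul' _ _ ENNReal.ofReal_ne_top]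
  gcongr
  exact h.lintegral_b_le n Q hQ y

/-- The stage cost contributes `b`, the continuation at most `C α b`. Hence `C ↦ 1 + C α` is the
update of the constant in all backward inductions. -/
lemma IsDominated.lintegral_enorm_stageCost_le (h : M.IsDominated α b) (n : Fin N) {v : E → ℝ}
    (hv : Measurable v) {C : ℝ} (hC : 0 ≤ C) (hvC : ∀ x, |v x| ≤ C * b x) {Q : Measure Z}
    (hQ : Q ∈ M.𝒬 n) (y : M.D n) :
    ∫⁻ z, ‖M.stageCost n v y z‖ₑ ∂Q ≤ ENNReal.ofReal ((1 + C * α) * b y.1.1) := by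
  have hT : Measurable fun z => M.T n (y, z) := (M.measurable_T n).comp measurable_prodMk_left
  calc ∫⁻ z, ‖M.stageCost n v y z‖ₑ ∂Q
      ≤ ∫⁻ z, (‖M.c n (y, M.T n (y, z))‖ₑ + ‖v (M.T n (y, z))‖ₑ) ∂Q :=
        lintegral_mono fun z => enorm_add_le _ _
    _ = ∫⁻ z, ‖M.c n (y, M.T n (y, z))‖ₑ ∂Q + ∫⁻ z, ‖v (M.T n (y, z))‖ₑ ∂Q :=
        lintegral_add_right _ (hv.comp hT).enorm
    _ ≤ ENNReal.ofReal (b y.1.1) + ENNReal.ofReal (C * (α * b y.1.1)) :=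
        add_le_add (h.lintegral_c_le n Q hQ y) <| (lintegral_mono fun z => by
          rw [← ofReal_norm]
          exact ENNReal.ofReal_le_ofReal (hvC _)).trans (h.lintegral_mul_le n hC hQ y)
    _ = _ := by
        have := h.nonneg_b y.1.1
        have := h.nonneg_α
        rw [← ENNReal.ofReal_add (by positivity) (by positivity)]
        ring_nf

lemma IsDominated.integrable_stageCost (h : M.IsDominated α b) (n : Fin N) {v : E → ℝ}
    (hv : Measurable v) {C : ℝ} (hC : 0 ≤ C) (hvC : ∀ x, |v x| ≤ C * b x) {Q : Measure Z}
    (hQ : Q ∈ M.𝒬 n) (y : M.D n) : Integrable (M.stageCost n v y) Q :=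
  ⟨((h.measurable_stageCost n hv).comp measurable_prodMk_left).aestronglyMeasurable,
    (h.lintegral_enorm_stageCost_le n hv hC hvC hQ y).trans_lt ENNReal.ofReal_lt_top⟩

lemma IsDominated.abs_L_le (h : M.IsDominated α b) (n : Fin N) {v : E → ℝ}
    (hv : Measurable v) {C : ℝ} (hC : 0 ≤ C) (hvC : ∀ x, |v x| ≤ C * b x) {Q : Measure Z}
    (hQ : Q ∈ M.𝒬 n) (y : M.D n) : |M.L n v y Q| ≤ (1 + C * α) * b y.1.1 := by
  have h1 := h.lintegral_enorm_stageCost_le n hv hC hvC hQ y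
  have h2 := (enorm_integral_le_lintegral_enorm (μ := Q) (M.stageCost n v y)).trans h1
  have := h.nonneg_b y.1.1
  have := h.nonneg_α
  rw [← ofReal_norm, ENNReal.ofReal_le_ofReal_iff (by positivity)] at h2
  exact h2

/-- Integration against a probability measure passes a constant error on unchanged, so the errors of
the stages simply add up. -/
lemma IsDominated.L_le_add (h : M.IsDominated α b) (n : Fin N) {v w : E → ℝ}
    (hv : Measurable v) {C : ℝ} (hC : 0 ≤ C) (hvC : ∀ x, |v x| ≤ C * b x) (hw : Measurable w)
    {C' : ℝ} (hC' : 0 ≤ C') (hwC : ∀ x, |w x| ≤ C' * b x) {Q : Measure Z}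
    (hQ : Q ∈ M.𝒬 n) (y : M.D n) {δ : ℝ} (hvw : ∀ x, v x ≤ w x + δ) :
    M.L n v y Q ≤ M.L n w y Q + δ := by
  have := M.isProbabilityMeasure_𝒬 n Q hQ
  have hw' := h.integrable_stageCost n hw hC' hwC hQ y
  calc M.L n v y Q ≤ ∫ z, (M.stageCost n w y z + δ) ∂Q :=
        integral_mono (h.integrable_stageCost n hv hC hvC hQ y) (hw'.add (integrable_const δ))
          fun z => by simpa [stageCost, add_assoc] using hvw _
    _ = M.L n w y Q + δ := by
        rw [integral_add hw' (integrable_const δ)]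
        simp [L]

/-! ### Evaluation of a pair of policies -/

/-- The value of a pair of policies, computed by backward recursion. -/
noncomputable def recursiveValue (M : RobustMDP E A Z N) (π : M.Policy) (γ : M.NaturePolicy)
    (n : ℕ) : E → ℝ :=
  if h : n < N then fun x =>
    M.L ⟨n, h⟩ (M.recursiveValue π γ (n + 1)) (π.pair ⟨n, h⟩ x) (γ.γ ⟨n, h⟩ (π.pair ⟨n, h⟩ x))
  else M.cN
termination_by N - n

lemma recursiveValue_of_lt (π : M.Policy) (γ : M.NaturePolicy) {n : ℕ} (h : n < N) (x : E) :
    M.recursiveValue π γ n x = M.L ⟨n, h⟩ (M.recursiveValue π γ (n + 1)) (π.pair ⟨n, h⟩ x)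
      (γ.γ ⟨n, h⟩ (π.pair ⟨n, h⟩ x)) := by
  rw [recursiveValue, dif_pos h]

lemma recursiveValue_of_le (π : M.Policy) (γ : M.NaturePolicy) {n : ℕ} (h : N ≤ n) :
    M.recursiveValue π γ n = M.cN := by
  rw [recursiveValue, dif_neg h.not_gt]

lemma IsDominated.recursiveValue_bound (h : M.IsDominated α b) (π : M.Policy) (γ : M.NaturePolicy)
    {n : ℕ} (hn : n ≤ N) : Measurable (M.recursiveValue π γ n) ∧
      ∃ C, 0 ≤ C ∧ ∀ x, |M.recursiveValue π γ n x| ≤ C * b x := by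
  induction hn using Nat.decreasingInduction with
  | self =>
    rw [recursiveValue_of_le π γ le_rfl]
    exact ⟨h.measurable_cN, 1, zero_le_one, fun x => by simpa using h.abs_cN_le x⟩
  | of_succ n hn ih =>
    obtain ⟨hm, C, hC, hvC⟩ := ih
    have hα := h.nonneg_α
    constructor
    · have h1 : Measurable fun y : E × Z =>
          M.stageCost ⟨n, hn⟩ (M.recursiveValue π γ (n + 1)) (π.pair ⟨n, hn⟩ y.1) y.2 :=
        (h.measurable_stageCost ⟨n, hn⟩ hm).comp
          (((π.measurable_pair ⟨n, hn⟩).comp measurable_fst).prodMk measurable_snd)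
      have h2 := (h1.stronglyMeasurable.integral_kernel_prod_right'
        (κ := M.disturbanceKernel π γ ⟨n, hn⟩)).measurable
      convert! h2 using 1
      ext x
      rw [recursiveValue_of_lt π γ hn]
      rfl
    · refine ⟨1 + C * α, by positivity, fun x => ?_⟩
      rw [recursiveValue_of_lt π γ hn]
      exact h.abs_L_le _ hm hC hvC (Subtype.coe_prop _) _

lemma transition_apply (π : M.Policy) (γ : M.NaturePolicy) (n : Fin N) (x : E) :
    M.transition π γ n x =
      (γ.γ n (π.pair n x) : Measure Z).map fun z => M.T n (π.pair n x, z) := by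
  have : IsProbabilityMeasure (γ.γ n (π.pair n x) : Measure Z) :=
    M.isProbabilityMeasure_𝒬 n _ (γ.γ n (π.pair n x)).2
  rw [transition, Kernel.map_apply _ (M.measurable_next π n), Kernel.prod_apply, Kernel.id_apply,
    Measure.dirac_prod, Measure.map_map (M.measurable_next π n) measurable_prodMk_left]
  rfl

lemma measurable_totalCost (hc : ∀ n, Measurable (M.c n)) (hcN : Measurable M.cN) (π : M.Policy)
    (n : ℕ) : Measurable (M.totalCost π n) := by
  refine Measurable.add (Finset.measurable_sum _ fun k _ => ?_) (hcN.comp (measurable_pi_apply N))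
  split_ifs
  · exact (hc k).comp (((π.measurable_pair k).comp (measurable_pi_apply _)).prodMk
      (measurable_pi_apply _))
  · exact measurable_const

lemma totalCost_eq_add (π : M.Policy) {n : ℕ} (hn : n < N) (ω : ℕ → E) :
    M.totalCost π n ω =
      M.c ⟨n, hn⟩ (π.pair ⟨n, hn⟩ (ω n), ω (n + 1)) + M.totalCost π (n + 1) ω := by
  rw [totalCost, totalCost, ← add_assoc]
  congr 1
  rw [← Finset.add_sum_erase _ _ (Finset.mem_univ (⟨n, hn⟩ : Fin N)),
    ← Finset.add_sum_erase Finset.univ (fun k : Fin N => if n + 1 ≤ (k : ℕ) then _ else (0 : ℝ))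
      (Finset.mem_univ (⟨n, hn⟩ : Fin N))]
  simp only [le_refl, if_true, Nat.not_succ_le_self, if_false, zero_add]
  congr 1
  refine Finset.sum_congr rfl fun k hk => ?_
  have hne : (k : ℕ) ≠ n := fun h => (Finset.ne_of_mem_erase hk) (Fin.ext h)
  have : n ≤ (k : ℕ) ↔ n + 1 ≤ k := by omega
  simp only [this]

section Trajectory

variable (π : M.Policy) (γ : M.NaturePolicy) {n : ℕ}

lemma map_traj_succ (hn : n < N) (h : (i : Finset.Iic n) → (fun _ : ℕ => E) i) :
    (Kernel.traj (X := fun _ => E) (M.historyKernel π γ) n h).map (fun ω => ω (n + 1)) =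
      (γ.γ ⟨n, hn⟩ (π.pair ⟨n, hn⟩ (h ⟨n, Finset.mem_Iic.2 le_rfl⟩)) : Measure Z).map
        fun z => M.T ⟨n, hn⟩ (π.pair ⟨n, hn⟩ (h ⟨n, Finset.mem_Iic.2 le_rfl⟩), z) := by
  rw [← Kernel.map_apply _ (measurable_pi_apply (n + 1)), Kernel.map_traj_succ_self,
    historyKernel, dif_pos hn, Kernel.comap_apply, transition_apply]

lemma lintegral_traj_succ (hn : n < N) (h : (i : Finset.Iic n) → (fun _ : ℕ => E) i)
    {g : E → ℝ≥0∞} (hg : Measurable g) :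
    ∫⁻ ω, g (ω (n + 1)) ∂Kernel.traj (X := fun _ => E) (M.historyKernel π γ) n h =
      ∫⁻ z, g (M.T ⟨n, hn⟩ (π.pair ⟨n, hn⟩ (h ⟨n, Finset.mem_Iic.2 le_rfl⟩), z))
        ∂(γ.γ ⟨n, hn⟩ (π.pair ⟨n, hn⟩ (h ⟨n, Finset.mem_Iic.2 le_rfl⟩)) : Measure Z) := by
  have hT : Measurable fun z =>
      M.T ⟨n, hn⟩ (π.pair ⟨n, hn⟩ (h ⟨n, Finset.mem_Iic.2 le_rfl⟩), z) :=
    (M.measurable_T _).comp measurable_prodMk_left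
  rw [← lintegral_map (f := g) hg (measurable_pi_apply (n + 1)), map_traj_succ π γ hn,
    lintegral_map hg hT]

lemma integral_traj_succ (hn : n < N) (h : (i : Finset.Iic n) → (fun _ : ℕ => E) i)
    {g : E → ℝ} (hg : Measurable g) :
    ∫ ω, g (ω (n + 1)) ∂Kernel.traj (X := fun _ => E) (M.historyKernel π γ) n h =
      ∫ z, g (M.T ⟨n, hn⟩ (π.pair ⟨n, hn⟩ (h ⟨n, Finset.mem_Iic.2 le_rfl⟩), z))
        ∂(γ.γ ⟨n, hn⟩ (π.pair ⟨n, hn⟩ (h ⟨n, Finset.mem_Iic.2 le_rfl⟩)) : Measure Z) := by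
  have hT : Measurable fun z =>
      M.T ⟨n, hn⟩ (π.pair ⟨n, hn⟩ (h ⟨n, Finset.mem_Iic.2 le_rfl⟩), z) :=
    (M.measurable_T _).comp measurable_prodMk_left
  have hX : Measurable fun ω : ℕ → E => ω (n + 1) := measurable_pi_apply (n + 1)
  rw [← integral_map hX.aemeasurable hg.aestronglyMeasurable, map_traj_succ π γ hn,
    integral_map hT.aemeasurable hg.aestronglyMeasurable]

/-- Conditioning on the history up to time `n + 1` leaves `C b(X_{n+1})`, whose expectation grows by
at most `α`. With nonnegative integrals the tower property needs no prior integrability. -/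
lemma IsDominated.lintegral_enorm_totalCost_succ_le (hM : M.IsDominated α b) (hn : n < N) {C : ℝ}
    (hC : 0 ≤ C) (hle : ∀ h : (i : Finset.Iic (n + 1)) → (fun _ : ℕ => E) i,
      ∫⁻ ω, ‖M.totalCost π (n + 1) ω‖ₑ
        ∂Kernel.traj (X := fun _ => E) (M.historyKernel π γ) (n + 1) h ≤
          ENNReal.ofReal (C * b (h ⟨n + 1, Finset.mem_Iic.2 le_rfl⟩)))
    (h : (i : Finset.Iic n) → (fun _ : ℕ => E) i) :
    ∫⁻ ω, ‖M.totalCost π (n + 1) ω‖ₑ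
      ∂Kernel.traj (X := fun _ => E) (M.historyKernel π γ) n h ≤
        ENNReal.ofReal (C * (α * b (h ⟨n, Finset.mem_Iic.2 le_rfl⟩))) := by
  have htm := (measurable_totalCost hM.measurable_c hM.measurable_cN π (n + 1)).enorm
  have hbm : Measurable fun w => ENNReal.ofReal (C * b w) :=
    (hM.measurable_b.const_mul C).ennreal_ofReal
  have hbm' : Measurable fun h : (i : Finset.Iic (n + 1)) → (fun _ : ℕ => E) i =>
      ENNReal.ofReal (C * b (h ⟨n + 1, Finset.mem_Iic.2 le_rfl⟩)) :=
    hbm.comp (measurable_pi_apply _)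
  rw [← Kernel.traj_comp_partialTraj (n.le_succ), Kernel.lintegral_comp _ _ _ htm]
  refine (lintegral_mono hle).trans ?_
  rw [← Kernel.traj_map_frestrictLe_apply,
    lintegral_map hbm' (Preorder.measurable_frestrictLe _)]
  refine (lintegral_traj_succ π γ hn h hbm).trans_le ?_
  exact hM.lintegral_mul_le _ hC (Subtype.coe_prop _) (π.pair ⟨n, hn⟩ _)

lemma IsDominated.lintegral_enorm_totalCost_le (hM : M.IsDominated α b) (hn : n ≤ N) :
    ∃ C, 0 ≤ C ∧ ∀ h : (i : Finset.Iic n) → (fun _ : ℕ => E) i,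
      ∫⁻ ω, ‖M.totalCost π n ω‖ₑ ∂Kernel.traj (X := fun _ => E) (M.historyKernel π γ) n h ≤
        ENNReal.ofReal (C * b (h ⟨n, Finset.mem_Iic.2 le_rfl⟩)) := by
  induction hn using Nat.decreasingInduction with
  | self =>
    refine ⟨1, zero_le_one, fun h => ?_⟩
    rw [Kernel.lintegral_traj _ (measurable_totalCost hM.measurable_c hM.measurable_cN π N).enorm]
    -- The trajectory law from time `N` freezes the coordinates up to `N` at `h`, and only the
    -- terminal cost remains.
    have : ∀ ω : ℕ → E, M.totalCost π N (Function.updateFinset ω (Finset.Iic N) h) =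
        M.cN (h ⟨N, Finset.mem_Iic.2 le_rfl⟩) := by
      intro ω
      have h0 : ∀ k : Fin N, ¬ N ≤ (k : ℕ) := fun k => k.2.not_ge
      simp [totalCost, h0, Function.updateFinset]
    simp only [this, lintegral_const, measure_univ, mul_one, one_mul]
    rw [← ofReal_norm]
    exact ENNReal.ofReal_le_ofReal (hM.abs_cN_le _)
  | of_succ n hn ih =>
    obtain ⟨C, hC, hle⟩ := ih
    have hα := hM.nonneg_α
    refine ⟨1 + C * α, by positivity, fun h => ?_⟩
    set x := h ⟨n, Finset.mem_Iic.2 le_rfl⟩ with hx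
    have hbx := hM.nonneg_b x
    have hcm : Measurable fun ω : ℕ → E =>
        ‖M.c ⟨n, hn⟩ (π.pair ⟨n, hn⟩ (ω n), ω (n + 1))‖ₑ :=
      ((hM.measurable_c _).comp (((π.measurable_pair _).comp (measurable_pi_apply _)).prodMk
        (measurable_pi_apply _))).enorm
    have h1 : ∫⁻ ω, ‖M.c ⟨n, hn⟩ (π.pair ⟨n, hn⟩ (ω n), ω (n + 1))‖ₑ
        ∂Kernel.traj (X := fun _ => E) (M.historyKernel π γ) n h ≤ ENNReal.ofReal (b x) := by
      rw [Kernel.lintegral_traj _ hcm]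
      have : ∀ ω : ℕ → E, Function.updateFinset ω (Finset.Iic n) h n = x ∧
          Function.updateFinset ω (Finset.Iic n) h (n + 1) = ω (n + 1) := by
        intro ω
        simp [Function.updateFinset, hx]
      simp only [this]
      rw [lintegral_traj_succ π γ hn h (g := fun w => ‖M.c ⟨n, hn⟩ (π.pair ⟨n, hn⟩ x, w)‖ₑ)
        ((hM.measurable_c _).comp measurable_prodMk_left).enorm]
      exact hM.lintegral_c_le _ _ (Subtype.coe_prop _) (π.pair ⟨n, hn⟩ x)
    have h2 := hM.lintegral_enorm_totalCost_succ_le π γ hn hC hle h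
    simp only [totalCost_eq_add π hn]
    refine (lintegral_mono fun ω => enorm_add_le _ _).trans ?_
    rw [lintegral_add_left hcm]
    refine (add_le_add h1 h2).trans_eq ?_
    rw [← hx, ← ENNReal.ofReal_add hbx (by positivity)]
    ring_nf

lemma IsDominated.integrable_totalCost (hM : M.IsDominated α b) (hn : n ≤ N)
    (h : (i : Finset.Iic n) → (fun _ : ℕ => E) i) : Integrable (M.totalCost π n)
      (Kernel.traj (X := fun _ => E) (M.historyKernel π γ) n h) := by
  obtain ⟨C, hC, hle⟩ := hM.lintegral_enorm_totalCost_le π γ hn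
  exact ⟨(measurable_totalCost hM.measurable_c hM.measurable_cN π n).aestronglyMeasurable,
    (hle h).trans_lt ENNReal.ofReal_lt_top⟩

/-- The tower property restarts the process from a random history, so the induction must cover
arbitrary histories; only the last coordinate matters by the Markov property. -/
lemma IsDominated.integral_totalCost (hM : M.IsDominated α b) (hn : n ≤ N)
    (h : (i : Finset.Iic n) → (fun _ : ℕ => E) i) :
    ∫ ω, M.totalCost π n ω ∂Kernel.traj (X := fun _ => E) (M.historyKernel π γ) n h =
      M.recursiveValue π γ n (h ⟨n, Finset.mem_Iic.2 le_rfl⟩) := by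
  induction hn using Nat.decreasingInduction with
  | self =>
    rw [Kernel.integral_traj _ (hM.integrable_totalCost π γ le_rfl h).1,
      recursiveValue_of_le π γ le_rfl]
    have : ∀ ω : ℕ → E, M.totalCost π N (Function.updateFinset ω (Finset.Iic N) h) =
        M.cN (h ⟨N, Finset.mem_Iic.2 le_rfl⟩) := by
      intro ω
      have h0 : ∀ k : Fin N, ¬ N ≤ (k : ℕ) := fun k => k.2.not_ge
      simp [totalCost, h0, Function.updateFinset]
    simp [this]
  | of_succ n hn ih =>
    obtain ⟨hVm, C, hC, hVC⟩ := hM.recursiveValue_bound π γ hn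
    set x := h ⟨n, Finset.mem_Iic.2 le_rfl⟩ with hx
    set μ := Kernel.traj (X := fun _ => E) (M.historyKernel π γ) n h with hμ
    have htot := hM.integrable_totalCost π γ hn.le h
    have hnext : Integrable (M.totalCost π (n + 1)) μ := by
      obtain ⟨C', hC', hle⟩ := hM.lintegral_enorm_totalCost_le π γ hn
      exact ⟨(measurable_totalCost hM.measurable_c hM.measurable_cN π _).aestronglyMeasurable,
        (hM.lintegral_enorm_totalCost_succ_le π γ hn hC' hle h).trans_lt ENNReal.ofReal_lt_top⟩
    have hcost : Integrable (fun ω => M.c ⟨n, hn⟩ (π.pair ⟨n, hn⟩ (ω n), ω (n + 1))) μ := by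
      refine (htot.sub hnext).congr (ae_of_all _ fun ω => ?_)
      simp [totalCost_eq_add π hn]
    have h1 : ∫ ω, M.c ⟨n, hn⟩ (π.pair ⟨n, hn⟩ (ω n), ω (n + 1)) ∂μ =
        ∫ ω, M.c ⟨n, hn⟩ (π.pair ⟨n, hn⟩ x, ω (n + 1)) ∂μ := by
      rw [hμ, Kernel.integral_traj _ hcost.1]
      have : ∀ ω : ℕ → E, Function.updateFinset ω (Finset.Iic n) h n = x ∧
          Function.updateFinset ω (Finset.Iic n) h (n + 1) = ω (n + 1) := by
        intro ω
        simp [Function.updateFinset, hx]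
      simp only [this]
    have hVm' : Measurable fun h : (i : Finset.Iic (n + 1)) → (fun _ : ℕ => E) i =>
        M.recursiveValue π γ (n + 1) (h ⟨n + 1, Finset.mem_Iic.2 le_rfl⟩) :=
      hVm.comp (measurable_pi_apply _)
    have h2 : ∫ ω, M.totalCost π (n + 1) ω ∂μ =
        ∫ ω, M.recursiveValue π γ (n + 1) (ω (n + 1)) ∂μ := by
      rw [hμ, ← Kernel.integral_traj_partialTraj n.le_succ hnext]
      simp only [ih]
      rw [← Kernel.traj_map_frestrictLe_apply, integral_map
        (Preorder.measurable_frestrictLe _).aemeasurable hVm'.aestronglyMeasurable]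
      rfl
    have hmc : Measurable fun w => M.c ⟨n, hn⟩ (π.pair ⟨n, hn⟩ x, w) :=
      (hM.measurable_c _).comp measurable_prodMk_left
    have hQ : (γ.γ ⟨n, hn⟩ (π.pair ⟨n, hn⟩ x) : Measure Z) ∈ M.𝒬 ⟨n, hn⟩ := Subtype.coe_prop _
    have hT : Measurable fun z => M.T ⟨n, hn⟩ (π.pair ⟨n, hn⟩ x, z) :=
      (M.measurable_T _).comp measurable_prodMk_left
    have hci : Integrable (fun z => M.c ⟨n, hn⟩ (π.pair ⟨n, hn⟩ x, M.T ⟨n, hn⟩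
        (π.pair ⟨n, hn⟩ x, z))) (γ.γ ⟨n, hn⟩ (π.pair ⟨n, hn⟩ x) : Measure Z) :=
      ⟨(hmc.comp hT).aestronglyMeasurable,
        (hM.lintegral_c_le _ _ hQ (π.pair ⟨n, hn⟩ x)).trans_lt ENNReal.ofReal_lt_top⟩
    have hVi : Integrable (fun z => M.recursiveValue π γ (n + 1) (M.T ⟨n, hn⟩
        (π.pair ⟨n, hn⟩ x, z))) (γ.γ ⟨n, hn⟩ (π.pair ⟨n, hn⟩ x) : Measure Z) := by
      refine ((hM.integrable_stageCost _ hVm hC hVC hQ (π.pair ⟨n, hn⟩ x)).sub hci).congr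
        (ae_of_all _ fun z => ?_)
      simp [stageCost]
    rw [integral_congr_ae (ae_of_all _ fun ω => totalCost_eq_add π hn ω),
      integral_add hcost hnext, h1, h2, hμ, integral_traj_succ π γ hn h hmc,
      integral_traj_succ π γ hn h hVm, recursiveValue_of_lt π γ hn,
      ← integral_add hci hVi]
    rfl

lemma IsDominated.policyValue_eq (hM : M.IsDominated α b) (hn : n ≤ N) (x : E) :
    M.policyValue π γ n x = M.recursiveValue π γ n x :=
  hM.integral_totalCost π γ hn fun _ => x

end Trajectory

end RobustMDP

namespace RobustMDP

variable {E A Z : Type*} [MeasurableSpace E] [MeasurableSpace A] [MeasurableSpace Z] {N : ℕ}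

/-! ### The Bellman operator -/

/-- The worst-case cost `sup_Q L_n v(x, a, Q)`. -/
noncomputable def robustL (M : RobustMDP E A Z N) (n : Fin N) (v : E → ℝ) (y : M.D n) : ℝ :=
  ⨆ Q : M.𝒬 n, M.L n v y Q

/-- The Bellman operator `v ↦ inf_a sup_Q L_n v(·, a, Q)`. -/
noncomputable def bellman (M : RobustMDP E A Z N) (n : Fin N) (v : E → ℝ) (x : E) : ℝ :=
  ⨅ a : M.section_D n x, M.robustL n v ⟨(x, a), a.2⟩

/-- Value iteration, backwards from the terminal cost. -/
noncomputable def bellmanIter (M : RobustMDP E A Z N) (n : ℕ) : E → ℝ :=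
  if h : n < N then M.bellman ⟨n, h⟩ (M.bellmanIter (n + 1)) else M.cN
termination_by N - n

/-- A bound of the integrands which is integrable to the power `p` and locally uniform in the
state-action pair. -/
def IsLocallyLpDominated [TopologicalSpace E] [TopologicalSpace A] (M : RobustMDP E A Z N)
    (b : E → ℝ) : Prop :=
  ∀ n, ∀ y₀ : M.D n, ∃ Θ₁ Θ₂ : Z → ℝ, MemLp Θ₁ M.p (M.P n) ∧ MemLp Θ₂ M.p (M.P n) ∧
    ∀ᶠ y in 𝓝 y₀, ∀ z, |M.c n (y, M.T n (y, z))| ≤ Θ₁ z ∧ b (M.T n (y, z)) ≤ Θ₂ z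

/-- With `b = bu - bl`, the bounds for the positive and negative parts add up to bounds for absolute
values. -/
lemma IsBounded.exists_isDominated [TopologicalSpace E] [TopologicalSpace A]
    {M : RobustMDP E A Z N} (hb : M.IsBounded) (hc : ∀ n, Measurable (M.c n))
    (hcN : Measurable M.cN) : ∃ α b, M.IsDominated α b ∧ M.IsLocallyLpDominated b := by
  obtain ⟨α, εl, εu, bl, bu, hα, -, hεl, hεu, -, hbl, hbu, hl, hu, hE, hN, hΘ⟩ := hb.bounding
  have hl0 : ∀ x, 0 ≤ -bl x := fun x => by linarith [hl x]
  have hu0 : ∀ x, 0 ≤ bu x := fun x => hεu.trans (hu x)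
  have hadd : ∀ x, ENNReal.ofReal (bu x - bl x) =
      ENNReal.ofReal (bu x) + ENNReal.ofReal (-bl x) := fun x => by
    rw [← ENNReal.ofReal_add (hu0 x) (hl0 x), sub_eq_add_neg]
  refine ⟨α, fun x => bu x - bl x, ⟨hα, hbu.sub hbl, fun x => by linarith [hl0 x, hu0 x], hc, hcN,
    fun n Q hQ y => ?_, fun n Q hQ y => ?_, fun x => ?_⟩, fun n y₀ => ?_⟩
  · obtain ⟨h1, -, h3, -⟩ := hE n Q hQ y
    have hT : Measurable fun z => M.T n (y, z) := (M.measurable_T n).comp measurable_prodMk_left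
    have hcT : Measurable fun z => M.c n (y, M.T n (y, z)) :=
      (hc n).comp (measurable_const.prodMk hT)
    calc ∫⁻ z, ‖M.c n (y, M.T n (y, z))‖ₑ ∂Q
        ≤ ∫⁻ z, (ENNReal.ofReal (M.c n (y, M.T n (y, z))) +
            ENNReal.ofReal (-M.c n (y, M.T n (y, z)))) ∂Q := by
          refine lintegral_mono fun z => ?_
          rw [← ofReal_norm, Real.norm_eq_abs]
          rcases abs_choice (M.c n (y, M.T n (y, z))) with h | h <;> rw [h]
          · exact le_self_add
          · exact le_add_self
      _ = _ := lintegral_add_left hcT.ennreal_ofReal _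
      _ ≤ _ := by
          rw [hadd]
          exact add_le_add h3 h1
  · obtain ⟨-, h2, -, h4⟩ := hE n Q hQ y
    have hT : Measurable fun z => M.T n (y, z) := (M.measurable_T n).comp measurable_prodMk_left
    have hbT : Measurable fun z => bu (M.T n (y, z)) := hbu.comp hT
    simp only [hadd]
    rw [lintegral_add_left hbT.ennreal_ofReal]
    refine (add_le_add h4 h2).trans_eq ?_
    rw [← ENNReal.ofReal_add (mul_nonneg hα (hu0 _)) (mul_nonneg hα (hl0 _))]
    ring_nf
  · rw [abs_le]
    constructor <;> linarith [(hN x).1, (hN x).2, hl0 x, hu0 x]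
  · obtain ⟨Θ₁, Θ₂, -, -, -, -, h1, h2, h⟩ := hΘ n y₀
    exact ⟨Θ₁, Θ₂, h1, h2, h⟩

variable {M : RobustMDP E A Z N} {α : ℝ} {b : E → ℝ}

lemma bellmanIter_of_lt {n : ℕ} (h : n < N) :
    M.bellmanIter n = M.bellman ⟨n, h⟩ (M.bellmanIter (n + 1)) := by
  rw [bellmanIter, dif_pos h]

lemma bellmanIter_of_le {n : ℕ} (h : N ≤ n) : M.bellmanIter n = M.cN := by
  rw [bellmanIter, dif_neg h.not_gt]

lemma nonempty_section_D (M : RobustMDP E A Z N) (n : Fin N) (x : E) :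
    Nonempty (M.section_D n x) := by
  obtain ⟨d, -, hd⟩ := M.exists_graph n
  exact ⟨⟨d x, hd x⟩⟩

section Bounds

variable (h : M.IsDominated α b) (n : Fin N) {v : E → ℝ} (hv : Measurable v) {C : ℝ} (hC : 0 ≤ C)
  (hvC : ∀ x, |v x| ≤ C * b x)

include h hv hC hvC

lemma IsDominated.L_le_robustL (y : M.D n) {Q : Measure Z} (hQ : Q ∈ M.𝒬 n) :
    M.L n v y Q ≤ M.robustL n v y := by
  refine le_ciSup (f := fun Q : M.𝒬 n => M.L n v y Q) ⟨(1 + C * α) * b y.1.1, ?_⟩ ⟨Q, hQ⟩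
  rintro _ ⟨Q, rfl⟩
  exact (le_abs_self _).trans (h.abs_L_le n hv hC hvC Q.2 y)

lemma IsDominated.abs_robustL_le (y : M.D n) : |M.robustL n v y| ≤ (1 + C * α) * b y.1.1 := by
  have hne : Nonempty (M.𝒬 n) := (M.nonempty_𝒬 n).to_subtype
  obtain ⟨Q, hQ⟩ := M.nonempty_𝒬 n
  rw [abs_le]
  constructor
  · exact (abs_le.1 (h.abs_L_le n hv hC hvC hQ y)).1.trans (h.L_le_robustL n hv hC hvC y hQ)
  · exact ciSup_le fun Q => (le_abs_self _).trans (h.abs_L_le n hv hC hvC Q.2 y)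

lemma IsDominated.bellman_le_robustL (y : M.D n) : M.bellman n v y.1.1 ≤ M.robustL n v y := by
  refine ciInf_le (f := fun a : M.section_D n y.1.1 => M.robustL n v ⟨(y.1.1, a), a.2⟩)
    ⟨-((1 + C * α) * b y.1.1), ?_⟩ ⟨y.1.2, y.2⟩
  rintro _ ⟨a, rfl⟩
  exact (abs_le.1 (h.abs_robustL_le n hv hC hvC ⟨(y.1.1, a), a.2⟩)).1

lemma IsDominated.abs_bellman_le (x : E) : |M.bellman n v x| ≤ (1 + C * α) * b x := by
  have hne := M.nonempty_section_D n x
  rw [abs_le]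
  constructor
  · exact le_ciInf fun a => (abs_le.1 (h.abs_robustL_le n hv hC hvC ⟨(x, a), a.2⟩)).1
  · obtain ⟨a⟩ := hne
    exact (h.bellman_le_robustL n hv hC hvC ⟨(x, a), a.2⟩).trans
      (abs_le.1 (h.abs_robustL_le n hv hC hvC ⟨(x, a), a.2⟩)).2

/-- The family is bounded, so the real supremum is not a default value and agrees with the extended
one. -/
lemma IsDominated.coe_robustL (y : M.D n) :
    (M.robustL n v y : EReal) = ⨆ Q : M.𝒬 n, (M.L n v y Q : EReal) := by
  have hne : Nonempty (M.𝒬 n) := (M.nonempty_𝒬 n).to_subtype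
  refine le_antisymm ?_ (iSup_le fun Q => EReal.coe_le_coe_iff.2 (h.L_le_robustL n hv hC hvC y Q.2))
  rw [← EReal.ge_of_forall_gt_iff_ge]
  intro r hr
  obtain ⟨Q, hQ⟩ := exists_lt_of_lt_ciSup (EReal.coe_lt_coe_iff.1 hr)
  exact (EReal.coe_le_coe_iff.2 hQ.le).trans
    (le_iSup (fun Q : M.𝒬 n => (M.L n v y Q : EReal)) Q)

lemma IsDominated.coe_bellman (x : E) : (M.bellman n v x : EReal) =
    ⨅ a : M.section_D n x, ⨆ Q : M.𝒬 n, (M.L n v ⟨(x, a), a.2⟩ Q : EReal) := by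
  have hne := M.nonempty_section_D n x
  simp only [← h.coe_robustL n hv hC hvC]
  refine le_antisymm (le_iInf fun a => EReal.coe_le_coe_iff.2
    (h.bellman_le_robustL n hv hC hvC ⟨(x, a), a.2⟩)) ?_
  rw [← EReal.le_of_forall_lt_iff_le]
  intro r hr
  obtain ⟨a, ha⟩ := exists_lt_of_ciInf_lt (EReal.coe_lt_coe_iff.1 hr)
  exact (iInf_le (fun a : M.section_D n x => (M.robustL n v ⟨(x, a), a.2⟩ : EReal)) a).trans
    (EReal.coe_le_coe_iff.2 ha.le)

end Bounds

/-- This places the integrand in the class of functions whose suprema over the ambiguity set are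
computed along one sequence. -/
lemma IsLocallyLpDominated.memLp_stageCost [TopologicalSpace E] [TopologicalSpace A]
    (hΘ : M.IsLocallyLpDominated b) (h : M.IsDominated α b) (n : Fin N) {v : E → ℝ}
    (hv : Measurable v) {C : ℝ} (hC : 0 ≤ C) (hvC : ∀ x, |v x| ≤ C * b x) (y : M.D n) :
    MemLp (M.stageCost n v y) M.p (M.P n) := by
  obtain ⟨Θ₁, Θ₂, h1, h2, hev⟩ := hΘ n y
  refine (h1.add (h2.const_mul C)).mono'
    ((h.measurable_stageCost n hv).comp measurable_prodMk_left).aestronglyMeasurable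
    (ae_of_all _ fun z => ?_)
  obtain ⟨hz1, hz2⟩ := hev.self_of_nhds z
  exact (abs_add_le _ _).trans (add_le_add hz1 ((hvC _).trans (mul_le_mul_of_nonneg_left hz2 hC)))

/-- Nature has measurable `ε`-optimal decision rules. -/
lemma exists_nature_rule [TopologicalSpace E] [TopologicalSpace A] (hb : M.IsBounded)
    (hΘ : M.IsLocallyLpDominated b) (h : M.IsDominated α b) (n : Fin N) {v : E → ℝ}
    (hv : Measurable v) {C : ℝ} (hC : 0 ≤ C) (hvC : ∀ x, |v x| ≤ C * b x) {ε : ℝ} (hε : 0 < ε) :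
    ∃ g : M.D n → M.𝒬 n, @Measurable _ _ _ (weakStarBorel M.p (M.P n) (M.𝒬 n)) g ∧
      ∀ y, M.robustL n v y ≤ M.L n v y (g y) + ε := by
  classical
  have := M.isProbabilityMeasure_P n
  have := M.isSeparable_P n
  obtain ⟨K, -, hK⟩ := hb.norm_bounded
  obtain ⟨Qs, hQs⟩ := exists_seq_integral_le_add M.conj M.one_lt_q (M.nonempty_𝒬 n)
    (M.isProbabilityMeasure_𝒬 n) (M.absolutelyContinuous_𝒬 n) (M.memLp_𝒬 n) (hK n)
  have hne : Nonempty (M.𝒬 n) := (M.nonempty_𝒬 n).to_subtype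
  -- Near-optimality is tested only within the sequence, so that for each `k` it is a countable
  -- intersection of measurable conditions on `y`.
  have hex : ∀ y, ∃ k, ∀ j, M.L n v y (Qs j) ≤ M.L n v y (Qs k) + ε / 2 := by
    intro y
    obtain ⟨Q, hQ⟩ := exists_lt_of_lt_ciSup
      (sub_lt_self (M.robustL n v y) (by positivity : 0 < ε / 4))
    obtain ⟨k, hk⟩ := hQs _ (hΘ.memLp_stageCost h n hv hC hvC y) Q Q.2 (ε / 4) (by positivity)
    refine ⟨k, fun j => ?_⟩
    have h1 := h.L_le_robustL n hv hC hvC y (Qs j).2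
    change M.L n v y Q ≤ M.L n v y (Qs k) + ε / 4 at hk
    linarith
  have hLm : ∀ j, Measurable fun y => M.L n v y (Qs j) := fun j => by
    have := M.isProbabilityMeasure_𝒬 n _ (Qs j).2
    exact (h.measurable_stageCost n hv).stronglyMeasurable.integral_prod_right'.measurable
  have hkm : Measurable fun y => Nat.find (hex y) := by
    refine measurable_find hex fun k => ?_
    rw [Set.ofPred_forall]
    exact MeasurableSet.iInter fun j => measurableSet_le (hLm j) ((hLm k).add_const _)
  refine ⟨fun y => Qs (Nat.find (hex y)), ?_, fun y => ?_⟩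
  -- The rule factors through `ℕ`, where every map is measurable, whatever the `σ`-algebra on the
  -- ambiguity set.
  · let _ := weakStarBorel M.p (M.P n) (M.𝒬 n)
    exact (measurable_from_nat (f := Qs)).comp hkm
  · refine ciSup_le fun Q => ?_
    obtain ⟨j, hj⟩ := hQs _ (hΘ.memLp_stageCost h n hv hC hvC y) Q Q.2 (ε / 2) (by positivity)
    change M.L n v y Q ≤ M.L n v y (Qs j) + ε / 2 at hj
    linarith [Nat.find_spec (hex y) j]

end RobustMDP

namespace RobustMDP

/-! ### Monotone models: decision rules and semicontinuity. -/

section Monotone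

variable {A Z : Type*} [TopologicalSpace A] [MeasurableSpace A] [MeasurableSpace Z] {N : ℕ}
  {M : RobustMDP ℝ A Z N} {α : ℝ} {b : ℝ → ℝ}

lemma IsMonotoneModel.measurable_c [TopologicalSpace.MetrizableSpace A]
    [SecondCountableTopology A] [BorelSpace A] (hm : M.IsMonotoneModel) (n : Fin N) :
    Measurable (M.c n) :=
  (hm.lsc_c n).measurable

lemma IsMonotoneModel.stageCost_mono (hm : M.IsMonotoneModel) (n : Fin N) {v : ℝ → ℝ}
    (hv : Monotone v) {y y' : M.D n} (ha : y.1.2 = y'.1.2) (hx : y.1.1 ≤ y'.1.1) (z : Z) :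
    M.stageCost n v y z ≤ M.stageCost n v y' z := by
  have hT := hm.monotone_T n y y' z ha hx
  exact add_le_add (hm.monotone_c n y y' _ _ ha hx hT) (hv hT)

lemma IsMonotoneModel.robustL_mono (hm : M.IsMonotoneModel) (h : M.IsDominated α b) (n : Fin N)
    {v : ℝ → ℝ} (hv : Monotone v) {C : ℝ} (hC : 0 ≤ C) (hvC : ∀ x, |v x| ≤ C * b x)
    {y y' : M.D n} (ha : y.1.2 = y'.1.2) (hx : y.1.1 ≤ y'.1.1) :
    M.robustL n v y ≤ M.robustL n v y' := by
  have hne : Nonempty (M.𝒬 n) := (M.nonempty_𝒬 n).to_subtype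
  refine ciSup_le fun Q => le_trans ?_ (h.L_le_robustL n hv.measurable hC hvC y' Q.2)
  exact integral_mono (h.integrable_stageCost n hv.measurable hC hvC Q.2 y)
    (h.integrable_stageCost n hv.measurable hC hvC Q.2 y') fun z => hm.stageCost_mono n hv ha hx z

/-- An action available at the larger state is also available at the smaller one, and is cheaper
there. -/
lemma IsMonotoneModel.monotone_bellman (hm : M.IsMonotoneModel) (h : M.IsDominated α b)
    (n : Fin N) {v : ℝ → ℝ} (hv : Monotone v) {C : ℝ} (hC : 0 ≤ C)
    (hvC : ∀ x, |v x| ≤ C * b x) : Monotone (M.bellman n v) := by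
  intro x x' hxx'
  have hne := M.nonempty_section_D n x'
  refine le_ciInf fun a => ?_
  have ha : (x, (a : A)) ∈ M.D n := hm.antitone_section n hxx' a.2
  exact (h.bellman_le_robustL n hv.measurable hC hvC ⟨(x, a), ha⟩).trans
    (hm.robustL_mono h n hv hC hvC rfl hxx')

/-- The controller has measurable `ε`-optimal decision rules. As the worst-case cost increases and
the set of admissible actions decreases with the state, an action which is nearly optimal at a
rational point slightly to the right of `x` is nearly optimal at `x`. -/
lemma IsMonotoneModel.exists_decision_rule (hm : M.IsMonotoneModel) (h : M.IsDominated α b)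
    (n : Fin N) {v : ℝ → ℝ} (hv : Monotone v) {C : ℝ} (hC : 0 ≤ C)
    (hvC : ∀ x, |v x| ≤ C * b x) (hcont : Continuous (M.bellman n v)) {ε : ℝ} (hε : 0 < ε) :
    ∃ d : ℝ → A, Measurable d ∧ ∀ x, ∃ hx : (x, d x) ∈ M.D n,
      M.robustL n v ⟨(x, d x), hx⟩ ≤ M.bellman n v x + ε := by
  classical
  obtain ⟨r, hr⟩ := TopologicalSpace.exists_dense_seq ℝ
  have hne := M.nonempty_section_D n
  have hopt : ∀ k, ∃ a : M.section_D n (r k),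
      M.robustL n v ⟨(r k, a), a.2⟩ < M.bellman n v (r k) + ε / 2 := fun k =>
    exists_lt_of_ciInf_lt (lt_add_of_pos_right _ (half_pos hε))
  choose a ha using hopt
  -- Continuity guarantees such a `k`. The first one need not be close to `x`: these two
  -- inequalities suffice.
  have hex : ∀ x, ∃ k, x ≤ r k ∧ M.bellman n v (r k) ≤ M.bellman n v x + ε / 2 := by
    intro x
    obtain ⟨δ, hδ, hδ'⟩ := Metric.continuousAt_iff.1 (hcont.continuousAt (x := x)) (ε / 2)
      (half_pos hε)
    obtain ⟨k, hk⟩ := hr.exists_mem_open isOpen_Ioo (nonempty_Ioo.2 (by linarith : x < x + δ))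
    refine ⟨k, hk.1.le, ?_⟩
    have := hδ' (x := r k) (by
      rw [Real.dist_eq, abs_of_nonneg] <;> linarith [hk.1, hk.2])
    rw [Real.dist_eq] at this
    linarith [(abs_lt.1 this).2]
  have hkm : Measurable fun x => Nat.find (hex x) := by
    refine measurable_find hex fun k => MeasurableSet.inter measurableSet_Iic ?_
    exact measurableSet_le measurable_const (hcont.measurable.add_const _)
  refine ⟨fun x => a (Nat.find (hex x)),
    (measurable_from_nat (f := fun k => (a k : A))).comp hkm, fun x => ?_⟩
  obtain ⟨h1, h2⟩ := Nat.find_spec (hex x)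
  set k := Nat.find (hex x)
  have hmem : (x, (a k : A)) ∈ M.D n := hm.antitone_section n h1 (a k).2
  refine ⟨hmem, (hm.robustL_mono h n hv hC hvC (y := ⟨(x, a k), hmem⟩)
    (y' := ⟨(r k, a k), (a k).2⟩) rfl h1).trans ?_⟩
  linarith [ha k]

lemma IsMonotoneModel.lowerSemicontinuous_stageCost (hm : M.IsMonotoneModel) (n : Fin N)
    {v : ℝ → ℝ} (hv : Monotone v) (hcont : Continuous v) (z : Z) :
    LowerSemicontinuous fun y => M.stageCost n v y z := by
  refine LowerSemicontinuous.add ?_ (hcont.comp_lowerSemicontinuous (hm.lsc_T n z) hv)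
  intro y₀ r hr
  -- `T` may jump upwards near `y₀`. Truncation at its value there restores convergence, and
  -- monotonicity of `c` in the next state removes the truncation afterwards.
  have hlim : Tendsto (fun y : M.D n => (y, min (M.T n (y, z)) (M.T n (y₀, z)))) (𝓝 y₀)
      (𝓝 (y₀, M.T n (y₀, z))) := by
    refine Filter.Tendsto.prodMk_nhds tendsto_id (tendsto_order.2 ⟨fun u hu => ?_, fun u hu => ?_⟩)
    · filter_upwards [hm.lsc_T n z y₀ u hu] with y hy using lt_min hy hu
    · exact Eventually.of_forall fun y => (min_le_right _ _).trans_lt hu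
  filter_upwards [hlim.eventually (hm.lsc_c n (y₀, M.T n (y₀, z)) r hr)] with y hy
  exact lt_of_lt_of_le hy (hm.monotone_c n y y _ _ rfl le_rfl (min_le_left _ _))

lemma IsMonotoneModel.lowerSemicontinuous_L [FirstCountableTopology A] (hm : M.IsMonotoneModel)
    (h : M.IsDominated α b) (hΘ : M.IsLocallyLpDominated b) (n : Fin N) {v : ℝ → ℝ}
    (hv : Monotone v) (hcont : Continuous v) {C : ℝ} (hC : 0 ≤ C) (hvC : ∀ x, |v x| ≤ C * b x)
    {Q : Measure Z} (hQ : Q ∈ M.𝒬 n) : LowerSemicontinuous fun y => M.L n v y Q := by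
  refine lowerSemicontinuous_integral (h.integrable_stageCost n hv.measurable hC hvC hQ)
    (hm.lowerSemicontinuous_stageCost n hv hcont) fun y₀ => ?_
  obtain ⟨Θ₁, Θ₂, h1, h2, hev⟩ := hΘ n y₀
  have := M.isProbabilityMeasure_P n
  have := M.isProbabilityMeasure_𝒬 n Q hQ
  refine ⟨fun z => Θ₁ z + C * Θ₂ z, integrable_of_memLp_rnDeriv M.conj
    (M.absolutelyContinuous_𝒬 n Q hQ) (M.memLp_𝒬 n Q hQ) (h1.add (h2.const_mul C)), ?_⟩
  filter_upwards [hev] with y hy z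
  obtain ⟨hz1, hz2⟩ := hy z
  have hz3 := (hvC (M.T n (y, z))).trans (mul_le_mul_of_nonneg_left hz2 hC)
  have := (abs_le.1 hz1).1
  have := (abs_le.1 hz3).1
  change _ ≤ M.c n (y, M.T n (y, z)) + v (M.T n (y, z))
  linarith

end Monotone

/-! ### Convex models: value iteration, optimality and interchange. -/

section Convex

variable {V : Type*} [AddCommGroup V] [Module ℝ V] {A : Set V} [MeasurableSpace A]
  {Z : Type*} [MeasurableSpace Z] {N : ℕ}
  {M : RobustMDP ℝ A Z N} {α : ℝ} {b : ℝ → ℝ}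

lemma IsConvexModel.exists_isComb (hc : M.IsConvexModel) (n : Fin N) {s t : ℝ} (hs : 0 ≤ s)
    (ht : 0 ≤ t) (hst : s + t = 1) (y₁ y₂ : M.D n) : ∃ y : M.D n, IsComb s t y₁.1 y₂.1 y.1 := by
  obtain ⟨y, hy, heq⟩ := hc.convex_D n (mem_image_of_mem _ y₁.2) (mem_image_of_mem _ y₂.2) hs ht hst
  simp only [Prod.ext_iff, Prod.fst_add, Prod.smul_fst, smul_eq_mul, Prod.snd_add,
    Prod.smul_snd] at heq
  exact ⟨⟨y, hy⟩, heq⟩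

variable [TopologicalSpace A]

/-- Composition with the convex `T` preserves convexity because `c` and `v` are also increasing in
the next state. -/
lemma IsConvexModel.L_le (hc : M.IsConvexModel) (hm : M.IsMonotoneModel) (h : M.IsDominated α b)
    (n : Fin N) {v : ℝ → ℝ} (hv : Monotone v) (hconv : ConvexOn ℝ univ v) {C : ℝ} (hC : 0 ≤ C)
    (hvC : ∀ x, |v x| ≤ C * b x) {s t : ℝ} (hs : 0 ≤ s) (ht : 0 ≤ t) (hst : s + t = 1)
    {y₁ y₂ y : M.D n} (hy : IsComb s t y₁.1 y₂.1 y.1) {Q : Measure Z} (hQ : Q ∈ M.𝒬 n) :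
    M.L n v y Q ≤ s * M.L n v y₁ Q + t * M.L n v y₂ Q := by
  have hi := h.integrable_stageCost n hv.measurable hC hvC hQ
  rw [L, L, L, ← integral_const_mul, ← integral_const_mul,
    ← integral_add ((hi y₁).const_mul s) ((hi y₂).const_mul t)]
  refine integral_mono (hi y) (((hi y₁).const_mul s).add ((hi y₂).const_mul t)) fun z => ?_
  have hT := hc.convex_T n z s t hs ht hst y₁ y₂ y hy
  have h1 := (hm.monotone_c n y y _ _ rfl le_rfl hT).trans
    (hc.convex_c n s t hs ht hst y₁ y₂ y _ _ hy)
  have h2 := (hv hT).trans (hconv.2 (mem_univ (M.T n (y₁, z))) (mem_univ (M.T n (y₂, z))) hs ht hst)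
  simp only [smul_eq_mul] at h2
  change M.c n _ + v _ ≤ s * (M.c n _ + v _) + t * (M.c n _ + v _)
  linarith

/-- A supremum of jointly convex functions is jointly convex, and so is its partial minimization
over the convex set `D_n`: nearly optimal actions at the endpoints are combined. -/
lemma IsConvexModel.convexOn_bellman (hc : M.IsConvexModel) (hm : M.IsMonotoneModel)
    (h : M.IsDominated α b) (n : Fin N) {v : ℝ → ℝ} (hv : Monotone v) (hconv : ConvexOn ℝ univ v)
    {C : ℝ} (hC : 0 ≤ C) (hvC : ∀ x, |v x| ≤ C * b x) : ConvexOn ℝ univ (M.bellman n v) := by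
  refine ⟨convex_univ, fun x₁ _ x₂ _ s t hs ht hst => ?_⟩
  have hne := M.nonempty_section_D n
  have hneQ : Nonempty (M.𝒬 n) := (M.nonempty_𝒬 n).to_subtype
  refine le_of_forall_pos_le_add fun ε hε => ?_
  obtain ⟨a₁, ha₁⟩ := exists_lt_of_ciInf_lt (lt_add_of_pos_right (M.bellman n v x₁) hε)
  obtain ⟨a₂, ha₂⟩ := exists_lt_of_ciInf_lt (lt_add_of_pos_right (M.bellman n v x₂) hε)
  obtain ⟨y, hy⟩ := hc.exists_isComb n hs ht hst ⟨(x₁, a₁), a₁.2⟩ ⟨(x₂, a₂), a₂.2⟩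
  have h1 : M.robustL n v y ≤ s * M.robustL n v ⟨(x₁, a₁), a₁.2⟩ +
      t * M.robustL n v ⟨(x₂, a₂), a₂.2⟩ := by
    refine ciSup_le fun Q => (hc.L_le hm h n hv hconv hC hvC hs ht hst hy Q.2).trans ?_
    gcongr
    · exact h.L_le_robustL n hv.measurable hC hvC _ Q.2
    · exact h.L_le_robustL n hv.measurable hC hvC _ Q.2
  have h2 := h.bellman_le_robustL n hv.measurable hC hvC y
  have hy1 : y.1.1 = s * x₁ + t * x₂ := hy.1
  rw [hy1] at h2
  simp only [smul_eq_mul]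
  have h3 := mul_le_mul_of_nonneg_left ha₁.le hs
  have h4 := mul_le_mul_of_nonneg_left ha₂.le ht
  have h5 : s * ε + t * ε = ε := by rw [← add_mul, hst, one_mul]
  linarith

/-- The properties are carried together: convexity of the next iterate needs monotonicity, and both
need the bound for integrability. -/
lemma IsConvexModel.bellmanIter_properties (hc : M.IsConvexModel) (hm : M.IsMonotoneModel)
    (h : M.IsDominated α b) {n : ℕ} (hn : n ≤ N) :
    Monotone (M.bellmanIter n) ∧ ConvexOn ℝ univ (M.bellmanIter n) ∧
      ∃ C, 0 ≤ C ∧ ∀ x, |M.bellmanIter n x| ≤ C * b x := by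
  induction hn using Nat.decreasingInduction with
  | self =>
    rw [bellmanIter_of_le le_rfl]
    exact ⟨hm.monotone_cN, hc.convex_cN, 1, zero_le_one, fun x => by simpa using h.abs_cN_le x⟩
  | of_succ n hn ih =>
    obtain ⟨hv, hconv, C, hC, hvC⟩ := ih
    have hα := h.nonneg_α
    rw [bellmanIter_of_lt hn]
    exact ⟨hm.monotone_bellman h _ hv hC hvC, hc.convexOn_bellman hm h _ hv hconv hC hvC,
      1 + C * α, by positivity, h.abs_bellman_le _ hv.measurable hC hvC⟩

lemma continuous_of_convexOn_univ {f : ℝ → ℝ} (hf : ConvexOn ℝ univ f) : Continuous f :=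
  continuousOn_univ.1 (hf.continuousOn isOpen_univ)

/-- A decision rule of nature that is `ε`-optimal for value iteration guarantees the iterates up to
an error against every policy of the controller. -/
lemma IsConvexModel.exists_naturePolicy_bellmanIter_le (hc : M.IsConvexModel)
    (hm : M.IsMonotoneModel) (hb : M.IsBounded) (h : M.IsDominated α b) (hΘ : M.IsLocallyLpDominated b) {ε : ℝ}
    (hε : 0 < ε) : ∃ γ : M.NaturePolicy, ∀ π : M.Policy, ∀ n ≤ N, ∀ x,
      M.bellmanIter n x ≤ M.recursiveValue π γ n x + ((N : ℝ) - n) * ε := by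
  have hrule : ∀ n : Fin N, ∃ g : M.D n → M.𝒬 n,
      @Measurable _ _ _ (weakStarBorel M.p (M.P n) (M.𝒬 n)) g ∧
        ∀ y, M.robustL n (M.bellmanIter (n + 1)) y ≤ M.L n (M.bellmanIter (n + 1)) y (g y) + ε := by
    intro n
    obtain ⟨hv, -, C, hC, hvC⟩ := hc.bellmanIter_properties hm h n.2
    exact exists_nature_rule hb hΘ h n hv.measurable hC hvC hε
  choose g hgm hg using hrule
  -- Nature's rule sees the action as well as the state, so one policy serves against every `π`.
  refine ⟨⟨g, hgm⟩, fun π n hn => ?_⟩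
  induction hn using Nat.decreasingInduction with
  | self => simp [bellmanIter_of_le, recursiveValue_of_le]
  | of_succ n hn ih =>
    intro x
    obtain ⟨hv, -, C, hC, hvC⟩ := hc.bellmanIter_properties hm h hn
    obtain ⟨hVm, C', hC', hVC⟩ := h.recursiveValue_bound π ⟨g, hgm⟩ hn
    rw [bellmanIter_of_lt hn, recursiveValue_of_lt π _ hn]
    have h1 := h.bellman_le_robustL ⟨n, hn⟩ hv.measurable hC hvC (π.pair ⟨n, hn⟩ x)
    have h2 := hg ⟨n, hn⟩ (π.pair ⟨n, hn⟩ x)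
    have h3 := h.L_le_add ⟨n, hn⟩ hv.measurable hC hvC hVm hC' hVC
      (g ⟨n, hn⟩ (π.pair ⟨n, hn⟩ x)).2 (π.pair ⟨n, hn⟩ x) ih
    push_cast at h3
    change M.bellman ⟨n, hn⟩ (M.bellmanIter (n + 1)) x ≤ _ at h1
    linarith

/-- The controller has policies that achieve the iterates up to an error against every policy of
nature. -/
lemma IsConvexModel.exists_policy_le_bellmanIter (hc : M.IsConvexModel) (hm : M.IsMonotoneModel)
    (h : M.IsDominated α b) {ε : ℝ} (hε : 0 < ε) : ∃ π : M.Policy, ∀ γ : M.NaturePolicy,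
      ∀ n ≤ N, ∀ x, M.recursiveValue π γ n x ≤ M.bellmanIter n x + ((N : ℝ) - n) * ε := by
  have hrule : ∀ n : Fin N, ∃ d : ℝ → A, Measurable d ∧ ∀ x, ∃ hx : (x, d x) ∈ M.D n,
      M.robustL n (M.bellmanIter (n + 1)) ⟨(x, d x), hx⟩ ≤
        M.bellman n (M.bellmanIter (n + 1)) x + ε := by
    intro n
    obtain ⟨hv, hconv, C, hC, hvC⟩ := hc.bellmanIter_properties hm h n.2
    exact hm.exists_decision_rule h n hv hC hvC
      (continuous_of_convexOn_univ (hc.convexOn_bellman hm h n hv hconv hC hvC)) hε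
  choose d hdm hdD hd using hrule
  let π : M.Policy := ⟨d, hdm, hdD⟩
  refine ⟨π, fun γ n hn => ?_⟩
  induction hn using Nat.decreasingInduction with
  | self => simp [bellmanIter_of_le, recursiveValue_of_le]
  | of_succ n hn ih =>
    intro x
    obtain ⟨hv, -, C, hC, hvC⟩ := hc.bellmanIter_properties hm h hn
    obtain ⟨hVm, C', hC', hVC⟩ := h.recursiveValue_bound π γ hn
    rw [bellmanIter_of_lt hn, recursiveValue_of_lt π _ hn]
    have hQ := (γ.γ ⟨n, hn⟩ (π.pair ⟨n, hn⟩ x)).2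
    have h1 := h.L_le_robustL ⟨n, hn⟩ hv.measurable hC hvC (π.pair ⟨n, hn⟩ x) hQ
    have h2 : M.robustL ⟨n, hn⟩ (M.bellmanIter (n + 1)) (π.pair ⟨n, hn⟩ x) ≤ _ := hd ⟨n, hn⟩ x
    have h3 := h.L_le_add ⟨n, hn⟩ hVm hC' hVC hv.measurable hC hvC hQ (π.pair ⟨n, hn⟩ x) ih
    push_cast at h3
    linarith

lemma IsConvexModel.valueE_eq (hc : M.IsConvexModel) (hm : M.IsMonotoneModel)
    (hb : M.IsBounded) (h : M.IsDominated α b) (hΘ : M.IsLocallyLpDominated b) {n : ℕ}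
    (hn : n ≤ N) (x : ℝ) : M.valueE n x = M.bellmanIter n x := by
  -- The denominator `N + 1` spreads `δ` over the stages and also covers `N = 0`.
  have hεle : ∀ δ > 0, ((N : ℝ) - n) * (δ / (N + 1)) ≤ δ := by
    intro δ hδ
    rw [mul_div_assoc', div_le_iff₀ (by positivity)]
    have : (0 : ℝ) ≤ n := n.cast_nonneg
    nlinarith
  refine le_antisymm ?_ ?_
  · rw [← EReal.le_of_forall_lt_iff_le]
    intro r hr
    have hδ : 0 < r - M.bellmanIter n x := sub_pos.2 (EReal.coe_lt_coe_iff.1 hr)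
    obtain ⟨π, hπ⟩ := hc.exists_policy_le_bellmanIter hm h (ε := (r - M.bellmanIter n x) / (N + 1))
      (by positivity)
    refine (iInf_le _ π).trans (iSup_le fun γ => EReal.coe_le_coe_iff.2 ?_)
    rw [h.policyValue_eq π γ hn]
    linarith [hπ γ n hn x, hεle _ hδ]
  · rw [← EReal.ge_of_forall_gt_iff_ge]
    intro r hr
    have hδ : 0 < M.bellmanIter n x - r := sub_pos.2 (EReal.coe_lt_coe_iff.1 hr)
    obtain ⟨γ, hγ⟩ := hc.exists_naturePolicy_bellmanIter_le hm hb h hΘ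
      (ε := (M.bellmanIter n x - r) / (N + 1)) (by positivity)
    refine le_iInf fun π => le_trans (EReal.coe_le_coe_iff.2 ?_)
      (le_iSup (fun γ => (M.policyValue π γ n x : EReal)) γ)
    rw [h.policyValue_eq π γ hn]
    linarith [hγ π n hn x, hεle _ hδ]

/-- Infimum and supremum in the Bellman operator can be interchanged for convex ambiguity sets. -/
lemma IsConvexModel.coe_bellman_eq_iSup_iInf [FirstCountableTopology A] (hc : M.IsConvexModel)
    (hm : M.IsMonotoneModel) (h : M.IsDominated α b) (hΘ : M.IsLocallyLpDominated b) (n : Fin N)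
    {v : ℝ → ℝ} (hv : Monotone v) (hconv : ConvexOn ℝ univ v) {C : ℝ} (hC : 0 ≤ C)
    (hvC : ∀ x, |v x| ≤ C * b x) (hQ : IsConvexMeasureSet (M.𝒬 n)) (x : ℝ) :
    (M.bellman n v x : EReal) =
      ⨆ Q : M.𝒬 n, ⨅ a : M.section_D n x, (M.L n v ⟨(x, a), a.2⟩ Q : EReal) := by
  have hne := M.nonempty_section_D n x
  have hneQ : Nonempty (M.𝒬 n) := (M.nonempty_𝒬 n).to_subtype
  have hcomp : CompactSpace (M.section_D n x) := isCompact_iff_compactSpace.1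
    (hm.isCompact_section n x)
  refine le_antisymm ?_ ?_
  · rw [← EReal.ge_of_forall_gt_iff_ge]
    intro r hr
    have hincl : Continuous fun a : M.section_D n x => (⟨(x, a), a.2⟩ : M.D n) := by fun_prop
    obtain ⟨Q, hQ'⟩ := exists_forall_le_of_forall_exists_lt (X := M.section_D n x) (ι := M.𝒬 n)
      (f := fun a Q => M.L n v ⟨(x, a), a.2⟩ Q) (r := r)
      (fun Q => (hm.lowerSemicontinuous_L h hΘ n hv (continuous_of_convexOn_univ hconv) hC hvC
        Q.2).comp hincl)
      (fun s t hs ht hst a₁ a₂ => by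
        obtain ⟨⟨⟨x', a⟩, hy⟩, hcomb⟩ :=
          hc.exists_isComb n hs ht hst ⟨(x, a₁), a₁.2⟩ ⟨(x, a₂), a₂.2⟩
        -- Combining two pairs over the same state keeps that state, so the combined action stays in
        -- the section over `x`.
        have hx : x' = x := by
          have h1 : x' = s * x + t * x := hcomb.1
          rw [h1, ← add_mul, hst, one_mul]
        subst hx
        exact ⟨⟨a, hy⟩, fun Q => hc.L_le hm h n hv hconv hC hvC hs ht hst hcomb Q.2⟩)
      -- The mixture of the two measures works, with equality, since the integral is affine in the
      -- measure.
      (fun s t hs ht hst Q₁ Q₂ => by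
        lift s to ℝ≥0 using hs
        lift t to ℝ≥0 using ht
        refine ⟨⟨_, hQ Q₁ Q₁.2 Q₂ Q₂.2 s t (by exact_mod_cast hst)⟩, fun a => ?_⟩
        have hi : ∀ Q : M.𝒬 n, Integrable (M.stageCost n v ⟨(x, a), a.2⟩) (Q : Measure Z) :=
          fun Q => h.integrable_stageCost n hv.measurable hC hvC Q.2 _
        rw [L, L, L, integral_add_measure ((hi Q₁).smul_measure_nnreal)
          ((hi Q₂).smul_measure_nnreal), integral_smul_nnreal_measure,
          integral_smul_nnreal_measure]
        rfl)
      (fun a => exists_lt_of_lt_ciSup ((EReal.coe_lt_coe_iff.1 hr).trans_le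
        (h.bellman_le_robustL n hv.measurable hC hvC ⟨(x, a), a.2⟩)))
    exact le_iSup_of_le Q (le_iInf fun a => EReal.coe_le_coe_iff.2 (hQ' a))
  · rw [h.coe_bellman n hv.measurable hC hvC]
    exact iSup_iInf_le_iInf_iSup _

end Convex

end RobustMDP

/-! ### The Bellman equation for the value functions. -/

theorem mainTheorem4 {V : Type*} [AddCommGroup V] [Module ℝ V] {A : Set V}
    [TopologicalSpace A] [TopologicalSpace.MetrizableSpace A] [SecondCountableTopology A]
    [MeasurableSpace A] [BorelSpace A] [StandardBorelSpace A]
    {Z : Type*} [MeasurableSpace Z] {N : ℕ} (M : RobustMDP ℝ A Z N)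
    (hb : M.IsBounded) (hm : M.IsMonotoneModel) (hc : M.IsConvexModel) :
    -- the values of all policy pairs and the value functions are well defined, finite, measurable
    (∀ n ≤ N, ∀ (π : M.Policy) (γ : M.NaturePolicy) (x : ℝ),
      Integrable (M.totalCost π n) (M.law π γ n x)) ∧
    (∀ n ≤ N, Measurable (M.value n) ∧ ∀ x, M.valueE n x = (M.value n x : EReal)) ∧
    ∀ n : Fin N,
      (∀ y : M.D n, ∀ Q ∈ M.𝒬 n, Integrable (M.stageCost n (M.value (n + 1)) y) Q) ∧
      ∀ x : ℝ,
        -- the Bellman equation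
        (M.value n x : EReal) = (⨅ a : M.section_D n x, ⨆ Q : M.𝒬 n,
          (M.L n (M.value (n + 1)) ⟨(x, a), a.2⟩ Q : EReal)) ∧
        -- the interchange of infimum and supremum
        (IsConvexMeasureSet (M.𝒬 n) → (M.value n x : EReal) = ⨆ Q : M.𝒬 n,
          ⨅ a : M.section_D n x, (M.L n (M.value (n + 1)) ⟨(x, a), a.2⟩ Q : EReal)) := by
  obtain ⟨α, b, h, hΘ⟩ := hb.exists_isDominated hm.measurable_c hm.monotone_cN.measurable
  -- Through this identification the value functions inherit the regularity and bounds of the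
  -- iterates.
  have hval : ∀ n ≤ N, M.value n = M.bellmanIter n := fun n hn => by
    ext x
    rw [RobustMDP.value, hc.valueE_eq hm hb h hΘ hn, EReal.toReal_coe]
  refine ⟨fun n hn π γ x => h.integrable_totalCost π γ hn _, fun n hn => ?_, fun n => ?_⟩
  · rw [hval n hn]
    exact ⟨(hc.bellmanIter_properties hm h hn).1.measurable, hc.valueE_eq hm hb h hΘ hn⟩
  · obtain ⟨hv, hconv, C, hC, hvC⟩ := hc.bellmanIter_properties hm h n.2
    rw [hval (n + 1) n.2, hval n n.2.le, RobustMDP.bellmanIter_of_lt n.2]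
    exact ⟨fun y Q hQ => h.integrable_stageCost n hv.measurable hC hvC hQ y, fun x =>
      ⟨h.coe_bellman n hv.measurable hC hvC x, fun hQ =>
        hc.coe_bellman_eq_iSup_iInf hm h hΘ n hv hconv hC hvC hQ x⟩⟩
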